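/- Let $r\in\{\infty,\omega\}$, let $M$ be a connected Hausdorff $C^r$-manifold of dimension $2$, and let $ds^2=\langle\cdot,\cdot\rangle$ be a positive semi-definite metric of class $C^r$ on $M$ (a $C^r$ field of symmetric positive semi-definite bilinear forms on the tangent spaces). A point $p$ is a *semi-definite point* if $ds^2$ is not positive definite at $p$; $\mathcal N_p=\{v\in T_pM : \langle v,w\rangle=0 \text{ for all } w\in T_pM\}$ is the null space. For vector fields $X,Y,Z$ of class $C^r$ put $$\Theta(X,Y,Z)=\tfrac12\bigl(X\langle Y,Z\rangle+Y\langle X,Z\rangle-Z\langle X,Y\rangle+\langle[X,Y],Z\rangle-\langle[X,Z],Y\rangle-\langle[Y,Z],X\rangle\bigr).$$ A semi-definite point $p$ is *admissible* if $\Theta(X,Y,Z)(p)=0$ for all $C^r$ vector fields $X,Y,Z$ defined near $p$ with $Z(p)\in\mathcal N_p$. The metric $ds^2$ is a *Kossowski metric* if each semi-definite point $p$ is admissible and there is a $C^r$ function $\lambda$ on a $C^r$ coordinate neighborhood $(U;u,v)$ of $p$ such that, writing $ds^2=E\,du^2+2F\,du\,dv+G\,dv^2$, one has $EG-F^2=\lambda^2$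 on $U$ and $(\lambda_u(p),\lambda_v(p))\neq(0,0)$. For a Kossowski metric, the semi-definite set near a semi-definite point $p$ is the image of a regular embedded $C^r$ curve $\sigma:(-\varepsilon,\varepsilon)\to M$ with $\sigma(0)=p$ (a *characteristic curve*), and $\mathcal N_p$ is one-dimensional. The semi-definite point $p$ is of type $A_2$ if $\sigma'(0)$ is linearly independent of the null direction, i.e. $\sigma'(0)$ and $\eta$ are linearly independent for a nonzero $\eta\in\mathcal N_p$. A semi-definite point $p$ is a *peak* if it has a neighborhood $U$ such that all semi-definite points in $U\setminus\{p\}$ are of type $A_2$. The *pre-distance function* of $ds^2$ is $$d_{ds^2}(p,q)=\inf_\gamma \int_a^b\sqrt{ds^2(\gamma'(t),\gamma'(t))}\,dt ,$$ the infimum being over all piecewise smooth arcs $\gamma:[a,b]\to M$ from $p$ to $q$. **Theorem.** Let $ds^2$ be a $C^r$ Kossowski metric on $M$ all of whose semi-definite points are peaks. Then $d_{ds^2}$ is a distance function on $M$ (a metric in the sense of metric spaces), and the topology it induces is the manifold topology of $M$. -/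

import Mathlib

open Set Filter Topology
open scoped Manifold ContDiff

noncomputable section

/-- The coordinate plane `ℝ²`. -/
abbrev Plane : Type := EuclideanSpace ℝ (Fin 2)

/-- A positive semi-definite metric of class `C^r` on a surface `M`: a `C^r` section of the bundle of
bilinear forms on the tangent spaces, symmetric and positive semi-definite at every point. -/
structure SemidefMetric (r : ℕ∞ω) (M : Type*) [TopologicalSpace M] [ChartedSpace Plane M]
    [IsManifold (𝓡 2) ∞ M] where
  form (x : M) : TangentSpace (𝓡 2) x →L[ℝ] TangentSpace (𝓡 2) x →L[ℝ] ℝ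
  symm (x : M) (v w : TangentSpace (𝓡 2) x) : form x v w = form x w v
  nonneg (x : M) (v : TangentSpace (𝓡 2) x) : 0 ≤ form x v v
  contMDiff : ContMDiff (𝓡 2) ((𝓡 2).prod 𝓘(ℝ, Plane →L[ℝ] Plane →L[ℝ] ℝ)) r
    (fun x ↦ Bundle.TotalSpace.mk' (Plane →L[ℝ] Plane →L[ℝ] ℝ)
      (E := fun x : M ↦ TangentSpace (𝓡 2) x →L[ℝ] TangentSpace (𝓡 2) x →L[ℝ] ℝ) x (form x))

namespace SemidefMetric

variable {r : ℕ∞ω} {M : Type*} [TopologicalSpace M] [ChartedSpace Plane M]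
  [IsManifold (𝓡 2) ∞ M]

/-- `p` is a semi-definite point: the form at `p` is not positive definite. -/
def IsSemidefPoint (g : SemidefMetric r M) (p : M) : Prop :=
  ¬ ∀ v : TangentSpace (𝓡 2) p, v ≠ 0 → 0 < g.form p v v

/-- The null space (radical) `𝒩_p` of the metric at `p`. -/
def nullSpace (g : SemidefMetric r M) (p : M) : Set (TangentSpace (𝓡 2) p) :=
  {v | ∀ w : TangentSpace (𝓡 2) p, g.form p v w = 0}

/-- The function `⟨X, Y⟩` of two vector fields. -/
def pairing (g : SemidefMetric r M) (X Y : Π x : M, TangentSpace (𝓡 2) x) (x : M) : ℝ :=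
  g.form x (X x) (Y x)

/-- The derivative `X f` of the function `f` along the vector field `X`, at `p`. -/
def dirDeriv (X : Π x : M, TangentSpace (𝓡 2) x) (f : M → ℝ) (p : M) : ℝ :=
  mfderiv (𝓡 2) 𝓘(ℝ) f p (X p)

/-- The Kossowski pseudo-connection `Θ(X, Y, Z)`. -/
def pseudoConnection (g : SemidefMetric r M) (X Y Z : Π x : M, TangentSpace (𝓡 2) x)
    (p : M) : ℝ :=
  (1 / 2 : ℝ) *
    (dirDeriv X (g.pairing Y Z) p + dirDeriv Y (g.pairing X Z) p - dirDeriv Z (g.pairing X Y) p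
      + g.pairing (VectorField.mlieBracket (𝓡 2) X Y) Z p
      - g.pairing (VectorField.mlieBracket (𝓡 2) X Z) Y p
      - g.pairing (VectorField.mlieBracket (𝓡 2) Y Z) X p)

/-- `X` is a vector field of class `C^r` on `U`. -/
def IsVectorFieldOn (r : ℕ∞ω) (X : Π x : M, TangentSpace (𝓡 2) x) (U : Set M) : Prop :=
  ContMDiffOn (𝓡 2) (𝓡 2).tangent r (fun x ↦ (⟨x, X x⟩ : TangentBundle (𝓡 2) M)) U

/-- `p` is admissible: the trilinear map `T_p M × T_p M × 𝒩_p → ℝ` induced by the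
pseudo-connection vanishes. Its values are computed with arbitrary `C^r` extensions of the vectors
to a neighbourhood of `p`. -/
def IsAdmissible (g : SemidefMetric r M) (p : M) : Prop :=
  ∀ U : Set M, IsOpen U → p ∈ U → ∀ X Y Z : Π x : M, TangentSpace (𝓡 2) x,
    IsVectorFieldOn r X U → IsVectorFieldOn r Y U → IsVectorFieldOn r Z U →
    Z p ∈ g.nullSpace p → g.pseudoConnection X Y Z p = 0

/-- The coordinate vector field `∂/∂x_i` of the chart `e`, at the point with coordinates `x`. -/
def coordVec (e : OpenPartialHomeomorph M Plane) (i : Fin 2) (x : Plane) :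
    TangentSpace (𝓡 2) (e.symm x) :=
  mfderiv 𝓘(ℝ, Plane) (𝓡 2) e.symm x (EuclideanSpace.single i (1 : ℝ) : Plane)

/-- The coefficients of the metric in the chart `e`, as functions of the coordinates:
`coeff e 0 0 = E`, `coeff e 0 1 = F` and `coeff e 1 1 = G`. -/
def coeff (g : SemidefMetric r M) (e : OpenPartialHomeomorph M Plane) (i j : Fin 2)
    (x : Plane) : ℝ :=
  g.form (e.symm x) (coordVec e i x) (coordVec e j x)

/-- A positive semi-definite metric is a Kossowski metric if every semi-definite point `p` is
admissible and there is a `C^r` function `lam` on a coordinate neighbourhood of `p` with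
`E G - F² = lam²` and `(lam_u, lam_v) ≠ (0, 0)` at `p`. -/
def IsKossowski (g : SemidefMetric r M) : Prop :=
  ∀ p : M, g.IsSemidefPoint p → g.IsAdmissible p ∧
    ∃ e ∈ IsManifold.maximalAtlas (𝓡 2) r M, p ∈ e.source ∧
      ∃ lam : Plane → ℝ, ContDiffOn ℝ r lam e.target ∧
        (∀ x ∈ e.target, g.coeff e 0 0 x * g.coeff e 1 1 x - g.coeff e 0 1 x ^ 2 = lam x ^ 2) ∧
        fderiv ℝ lam (e p) ≠ 0

/-- The velocity `γ'(t)` of a curve. -/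
def velocity (γ : ℝ → M) (t : ℝ) : TangentSpace (𝓡 2) (γ t) :=
  mfderiv 𝓘(ℝ, ℝ) (𝓡 2) γ t (1 : ℝ)

/-- `σ : (-ε, ε) → M` is a characteristic curve through `p`: a regular embedded `C^r` curve with
`σ(0) = p` which parametrizes the set of semi-definite points in a neighbourhood of `p`. -/
structure IsCharacteristicCurve (g : SemidefMetric r M) (p : M) (ε : ℝ) (σ : ℝ → M) : Prop where
  pos : 0 < ε
  map_zero : σ 0 = p
  contMDiffOn : ContMDiffOn 𝓘(ℝ, ℝ) (𝓡 2) r σ (Ioo (-ε) ε)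
  regular : ∀ t ∈ Ioo (-ε) ε, velocity σ t ≠ 0
  isEmbedding : IsEmbedding ((Ioo (-ε) ε).domRestrict σ)
  image_eq : ∃ U : Set M, IsOpen U ∧ p ∈ U ∧ σ '' Ioo (-ε) ε = {q ∈ U | g.IsSemidefPoint q}

/-- `p` is a semi-definite point of type `A₂`: the velocity at `p` of the characteristic curve is
linearly independent of the null direction at `p`. -/
def IsA2Point (g : SemidefMetric r M) (p : M) : Prop :=
  g.IsSemidefPoint p ∧ ∃ (ε : ℝ) (σ : ℝ → M), g.IsCharacteristicCurve p ε σ ∧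
    ∃ η ∈ g.nullSpace (σ 0), LinearIndependent ℝ ![velocity σ 0, η]

/-- `p` is a peak: a semi-definite point with a neighbourhood `U` such that every semi-definite
point in `U \ {p}` is of type `A₂`. -/
def IsPeak (g : SemidefMetric r M) (p : M) : Prop :=
  g.IsSemidefPoint p ∧ ∃ U ∈ 𝓝 p, ∀ q ∈ U \ {p}, g.IsSemidefPoint q → g.IsA2Point q

/-- `γ` is piecewise smooth on `[a, b]`: it is a finite concatenation of arcs that are smooth on
closed intervals. -/
inductive IsPiecewiseSmooth (γ : ℝ → M) : ℝ → ℝ → Prop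
  | smooth {a b : ℝ} (hab : a ≤ b) (h : ContMDiffOn 𝓘(ℝ, ℝ) (𝓡 2) ∞ γ (Icc a b)) :
      IsPiecewiseSmooth γ a b
  | append {a b c : ℝ} (hab : IsPiecewiseSmooth γ a b) (hbc : IsPiecewiseSmooth γ b c) :
      IsPiecewiseSmooth γ a c

/-- The length of the arc `γ : [a, b] → M` with respect to the metric. -/
def arcLength (g : SemidefMetric r M) (γ : ℝ → M) (a b : ℝ) : ℝ :=
  ∫ t in a..b, √(g.form (γ t) (velocity γ t) (velocity γ t))

/-- The pre-distance of `p` and `q`: the infimum of the lengths of the piecewise smooth arcs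
joining `p` to `q`. -/
def preDist (g : SemidefMetric r M) (p q : M) : ℝ :=
  sInf {L : ℝ | ∃ (a b : ℝ) (γ : ℝ → M), IsPiecewiseSmooth γ a b ∧ γ a = p ∧ γ b = q ∧
    L = g.arcLength γ a b}

end SemidefMetric

end

set_option linter.unusedSectionVars false

noncomputable section

/-! Symmetry and the triangle inequality come from reversing and concatenating arcs. Segments in
charts show that nearby points are joined by short arcs (`eventually_exists_hasArc_lt`); with
connectedness, any two points are joined by an arc (`exists_hasArc`), and the pre-distance is finite
and continuous for the manifold topology. What remains is separation (`IsSeparated`): arcs from `p`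
that leave a given neighbourhood have length bounded below by some `ε > 0`. This gives both
definiteness and the equality of the topologies.

Separation follows from a barrier, a function `Ψ` with a strict local minimum `0` at `p` and `|dΨ| ≤
C √Q`: an arc that reaches a small coordinate sphere must pay at least `min Ψ / C` in length. At a
positive definite point `‖x - x₀‖²` is a barrier. At an `A₂` point, `√Q` degenerates along the
semi-definite curve `λ = 0` but still controls two things: a nonzero row `β` of the Gram matrix, and
`|λ| ‖v‖`, because `det = λ²`. In `Ψ = φ² + λ²` the term `λ dλ` is therefore harmless, and `φ = ℓ(x
- x₀) + λ h` is chosen so that `dφ` is a multiple of `β` up to a term `λ dh`. This works because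
`A₂` makes the kernel of `β` transversal to the curve (`exists_isBarrier_of_transversal`).

At a peak that is not `A₂` no local analysis is made. All other nearby points are already separated,
so the pre-distance to the peak is positive on a small circle around it; being continuous, it has a
positive minimum there, and every arc from the peak that leaves the disc crosses the circle
(`IsSeparated.of_eventually`). -/

/-- `Ψ` is a local barrier at `x₀` for the field of quadratic forms `Q`: it has a strict local
minimum with value `0` at `x₀`, and its differential is controlled by `√Q`. -/
def IsBarrier (Q : Plane → Plane → ℝ) (x₀ : Plane) (Ψ : Plane → ℝ) (C : ℝ) : Prop :=
  Ψ x₀ = 0 ∧ ∀ᶠ x in 𝓝 x₀, DifferentiableAt ℝ Ψ x ∧ (x ≠ x₀ → 0 < Ψ x) ∧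
    ∀ v, |fderiv ℝ Ψ x v| ≤ C * √(Q x v)

/-! ### Linear forms on the plane -/

/-- The linear form with coefficients `a`, `b`. -/
def planeForm (a b : ℝ) : Plane →L[ℝ] ℝ :=
  a • EuclideanSpace.proj (𝕜 := ℝ) (0 : Fin 2) + b • EuclideanSpace.proj (𝕜 := ℝ) (1 : Fin 2)

@[simp] lemma planeForm_apply (a b : ℝ) (v : Plane) : planeForm a b v = a * v 0 + b * v 1 := by
  simp [planeForm]

/-- A vector spanning the kernel of `planeForm a b`. -/
def planeRot (a b : ℝ) : Plane :=
  (-b) • EuclideanSpace.single (0 : Fin 2) (1 : ℝ) + a • EuclideanSpace.single (1 : Fin 2) (1 : ℝ)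

@[simp] lemma planeRot_zero (a b : ℝ) : planeRot a b 0 = -b := by simp [planeRot]

@[simp] lemma planeRot_one (a b : ℝ) : planeRot a b 1 = a := by simp [planeRot]

lemma plane_vec_eq (v : Plane) : v = v 0 • EuclideanSpace.single (0 : Fin 2) (1 : ℝ)
    + v 1 • EuclideanSpace.single (1 : Fin 2) (1 : ℝ) := by
  ext i; fin_cases i <;> simp

lemma planeForm_of_clm (f : Plane →L[ℝ] ℝ) : f = planeForm (f (EuclideanSpace.single 0 1))
    (f (EuclideanSpace.single 1 1)) := by
  ext v
  conv_lhs => rw [plane_vec_eq v]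
  simp only [map_add, map_smul, smul_eq_mul, planeForm_apply]; ring

/-- In the plane, a form vanishing on the kernel of a nonzero form is a multiple of it.
Cross-multiplying removes the need for `(a, b) ≠ 0`. -/
lemma clm_mul_eq_of_apply_planeRot_eq_zero (α : Plane →L[ℝ] ℝ) (a b : ℝ)
    (h : α (planeRot a b) = 0) (v w : Plane) :
    α v * planeForm a b w = α w * planeForm a b v := by
  rw [planeForm_of_clm α] at h ⊢
  simp only [planeForm_apply, planeRot_zero, planeRot_one] at h ⊢
  linear_combination (v 1 * w 0 - v 0 * w 1) * h

/-- Two linear forms on the plane whose kernels meet only in `0` embed the plane. -/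
lemma exists_antilipschitz_prod (α β : Plane →L[ℝ] ℝ)
    (h : ∀ v, α v = 0 → β v = 0 → v = 0) : ∃ C, AntilipschitzWith C (α.prod β) := by
  have hk : (α.prod β : Plane →L[ℝ] ℝ × ℝ).toLinearMap.ker = ⊥ := by
    refine LinearMap.ker_eq_bot'.2 fun v hv => ?_
    have := Prod.ext_iff.1 hv
    exact h v this.1 this.2
  obtain ⟨K, -, hK⟩ := LinearMap.exists_antilipschitzWith _ hk
  exact ⟨K, hK⟩

/-! ### The barrier at a degenerate point -/

/-- Suppose `√Q` controls the form `b = b₀ dx₀ + b₁ dx₁` as well as `|lam| · ‖v‖`, and the kernel of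
`b` is transversal to the curve `lam = 0` at `x₀`. With `φ = ℓ + lam h`, where `ℓ` is linear and `h`
makes `ℓ + h dlam` proportional to `b`, the function `φ² + lam²` is a barrier. -/
lemma exists_isBarrier_of_transversal (Q : Plane → Plane → ℝ) (b₀ b₁ lam : Plane → ℝ) (x₀ : Plane)
    (hb₀ : ContDiffAt ℝ 1 b₀ x₀) (hb₁ : ContDiffAt ℝ 1 b₁ x₀) (hlam : ContDiffAt ℝ 2 lam x₀)
    (hlam₀ : lam x₀ = 0) (B T : ℝ)
    (hB : ∀ᶠ x in 𝓝 x₀, ∀ v, |planeForm (b₀ x) (b₁ x) v| ≤ B * √(Q x v))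
    (hT : ∀ᶠ x in 𝓝 x₀, ∀ v, |lam x| * ‖v‖ ≤ T * √(Q x v))
    (hη : fderiv ℝ lam x₀ (planeRot (b₀ x₀) (b₁ x₀)) ≠ 0) :
    ∃ Ψ C, IsBarrier Q x₀ Ψ C := by
  set η : Plane → Plane := fun x => planeRot (b₀ x) (b₁ x) with hηdef
  have hηC : ContDiffAt ℝ 1 η x₀ := by
    simp only [hηdef, planeRot]; fun_prop
  set ℓ : Plane →L[ℝ] ℝ := planeForm (b₀ x₀) (b₁ x₀) with hℓ
  have hdlam : ContDiffAt ℝ 1 (fderiv ℝ lam) x₀ := hlam.fderiv_right (by norm_num)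
  have hden : ContDiffAt ℝ 1 (fun x => fderiv ℝ lam x (η x)) x₀ := hdlam.clm_apply hηC
  -- Solves `(ℓ + h dλ)(η) = 0`. Since `λ` is `C²`, `h` is `C¹`, and `h x₀ = 0` because `ℓ` kills `η
  -- x₀`.
  set h : Plane → ℝ := fun x => -(ℓ (η x)) / fderiv ℝ lam x (η x) with hh
  have hhC : ContDiffAt ℝ 1 h x₀ := (ℓ.contDiff.contDiffAt.comp x₀ hηC).neg.div hden hη
  have hh₀ : h x₀ = 0 := by simp [hh, hηdef, hℓ]; left; ring
  set φ : Plane → ℝ := fun x => ℓ (x - x₀) + lam x * h x with hφ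
  set w : Plane := !₂[b₀ x₀, b₁ x₀] with hw
  have hb : (b₀ x₀) ^ 2 + (b₁ x₀) ^ 2 ≠ 0 := by
    intro hb
    have h1 : b₀ x₀ = 0 := by nlinarith [sq_nonneg (b₀ x₀), sq_nonneg (b₁ x₀)]
    have h2 : b₁ x₀ = 0 := by nlinarith [sq_nonneg (b₀ x₀), sq_nonneg (b₁ x₀)]
    simp [h1, h2, planeRot] at hη
  set α : Plane → (Plane →L[ℝ] ℝ) := fun x => ℓ + h x • fderiv ℝ lam x with hα
  -- The proportionality factor in `α = c β`. It is read off at the fixed vector `w`, where `β`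
  -- equals `b₀² + b₁² ≠ 0` at `x₀`, so it stays bounded near `x₀`.
  set c : Plane → ℝ := fun x => α x w / planeForm (b₀ x) (b₁ x) w with hc
  have hβw : planeForm (b₀ x₀) (b₁ x₀) w ≠ 0 := by
    simp only [planeForm_apply, hw]; simp; intro h; apply hb; linarith
  have hβC : ContinuousAt (fun x => planeForm (b₀ x) (b₁ x) w) x₀ := by
    simp only [planeForm_apply]
    exact (hb₀.continuousAt.mul continuousAt_const).add (hb₁.continuousAt.mul continuousAt_const)
  have hcC : ContinuousAt c x₀ := by
    refine ContinuousAt.div ?_ hβC hβw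
    have h1 : ContinuousAt α x₀ :=
      continuousAt_const.add (hhC.continuousAt.smul hdlam.continuousAt)
    exact h1.clm_apply continuousAt_const
  have hdh : ContinuousAt (fderiv ℝ h) x₀ := (hhC.fderiv_right (m := 0) (by norm_num)).continuousAt
  have hlam1 := hlam.of_le (m := 1) (by norm_num)
  have hφC : ContDiffAt ℝ 1 φ x₀ := by
    refine ContDiffAt.add ?_ (hlam1.mul hhC)
    exact ℓ.contDiff.contDiffAt.comp x₀ (contDiffAt_id.sub contDiffAt_const)
  -- injectivity of `(ℓ, lam)` near `x₀`
  have hinj : ∀ᶠ x in 𝓝 x₀, x ≠ x₀ → 0 < φ x ^ 2 + lam x ^ 2 := by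
    have hd : HasFDerivAt (fun x => (ℓ (x - x₀), lam x)) (ℓ.prod (fderiv ℝ lam x₀)) x₀ := by
      refine HasFDerivAt.prodMk ?_ (hlam1.differentiableAt (by norm_num)).hasFDerivAt
      simpa using ℓ.hasFDerivAt (x := x₀)
    -- The kernel of `ℓ` is spanned by `η x₀`, on which `dλ` does not vanish. So `(ℓ, λ)` avoids the
    -- value `(0, 0)` at nearby points other than `x₀`; and where `λ = 0`, `φ` reduces to `ℓ (x -
    -- x₀)`.
    have hanti := exists_antilipschitz_prod ℓ (fderiv ℝ lam x₀) (by
      intro v hv1 hv2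
      have e1 : b₀ x₀ * v 0 + b₁ x₀ * v 1 = 0 := by simpa [hℓ] using hv1
      set k : ℝ := (b₀ x₀ * v 1 - b₁ x₀ * v 0) / ((b₀ x₀) ^ 2 + (b₁ x₀) ^ 2)
      have hvk : v = k • planeRot (b₀ x₀) (b₁ x₀) := by
        ext i; fin_cases i
        · simp [k]; field_simp; linear_combination (b₀ x₀) * e1
        · simp [k]; field_simp; linear_combination (b₁ x₀) * e1
      rw [hvk, map_smul, smul_eq_mul] at hv2
      rcases mul_eq_zero.1 hv2 with h0 | h0
      · rw [hvk, h0, zero_smul]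
      · exact absurd h0 hη)
    have := hd.eventually_ne (c := (0, 0)) hanti
    rw [eventually_nhdsWithin_iff] at this
    filter_upwards [this] with x hx hne
    by_contra hcon
    have h1 : lam x = 0 := by nlinarith [sq_nonneg (φ x), sq_nonneg (lam x)]
    have h2 : φ x = 0 := by nlinarith [sq_nonneg (φ x), sq_nonneg (lam x)]
    refine hx hne ?_
    simp only [hφ, h1, zero_mul, add_zero] at h2
    simp [h1, h2]
  have hev := fun (f : Plane → ℝ) (hf : ContinuousAt f x₀) =>
    (hf.abs.eventually_lt (continuousAt_const (y := |f x₀| + 1)) (by linarith))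
  have hdlam1 : ContinuousAt (fun x => fderiv ℝ lam x) x₀ := hdlam.continuousAt
  -- Near `x₀` each continuous factor of `2 φ (c β + λ dh) + 2 λ dλ` is bounded by its absolute
  -- value at `x₀` plus one; `|B|` and `|T|` control `β` and `λ`.
  refine ⟨fun x => φ x ^ 2 + lam x ^ 2, 2 * (|φ x₀| + 1) * ((|c x₀| + 1) * |B|
      + (|‖fderiv ℝ h x₀‖| + 1) * |T|) + 2 * (|‖fderiv ℝ lam x₀‖| + 1) * |T|, ?_, ?_⟩
  · simp [hφ, hlam₀]
  have hdiff : ∀ (f : Plane → ℝ), ContDiffAt ℝ 1 f x₀ → ∀ᶠ x in 𝓝 x₀, DifferentiableAt ℝ f x :=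
    fun f hf => (hf.eventually (by simp)).mono fun x hx => hx.differentiableAt (by norm_num)
  filter_upwards [hinj, hB, hT, hev c hcC, hev _ hdh.norm, hev _ hdlam1.norm,
    hev φ hφC.continuousAt, hdiff _ hφC, hdiff _ hlam1, hdiff _ hhC, hβC.eventually_ne hβw,
    hden.continuousAt.eventually_ne hη] with x i1 i2 i3 i4 i5 i6 i7 d1 d2 d3 hbx hdx
  refine ⟨(d1.pow 2).add (d2.pow 2), i1, fun v => ?_⟩
  have hφ' : fderiv ℝ φ x = α x + lam x • fderiv ℝ h x := by
    have h1 : HasFDerivAt φ (ℓ + (lam x • fderiv ℝ h x + h x • fderiv ℝ lam x)) x := by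
      refine HasFDerivAt.add ?_ (d2.hasFDerivAt.mul d3.hasFDerivAt)
      simpa using ℓ.hasFDerivAt (x := x)
    rw [h1.fderiv, hα]; simp only; abel
  have hΨ : fderiv ℝ (fun x => φ x ^ 2 + lam x ^ 2) x v =
      2 * φ x * fderiv ℝ φ x v + 2 * (lam x * fderiv ℝ lam x v) := by
    have h1 := (d1.hasFDerivAt.pow 2).add (d2.hasFDerivAt.pow 2)
    have h2 : HasFDerivAt (fun x => φ x ^ 2 + lam x ^ 2) _ x := h1
    rw [h2.fderiv]; simp; ring
  have hαη : α x (planeRot (b₀ x) (b₁ x)) = 0 := by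
    simp only [hα, add_apply, smul_apply, smul_eq_mul, hh]
    change ℓ (η x) + -(ℓ (η x)) / fderiv ℝ lam x (η x) * fderiv ℝ lam x (η x) = 0
    field_simp; ring
  have hαv : α x v = c x * planeForm (b₀ x) (b₁ x) v := by
    have := clm_mul_eq_of_apply_planeRot_eq_zero (α x) (b₀ x) (b₁ x) hαη v w
    simp only [hc]; field_simp; linarith
  have hs : 0 ≤ √(Q x v) := Real.sqrt_nonneg _
  set s := √(Q x v)
  have j2 : |planeForm (b₀ x) (b₁ x) v| ≤ |B| * s :=
    (i2 v).trans (mul_le_mul_of_nonneg_right (le_abs_self _) hs)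
  have j3 : |lam x| * ‖v‖ ≤ |T| * s :=
    (i3 v).trans (mul_le_mul_of_nonneg_right (le_abs_self _) hs)
  have e1 : |α x v| ≤ (|c x₀| + 1) * (|B| * s) := by
    rw [hαv, abs_mul]
    exact mul_le_mul i4.le j2 (abs_nonneg _) (by positivity)
  have hlin : ∀ (f : Plane →L[ℝ] ℝ) (K : ℝ), |‖f‖| < K → |lam x * f v| ≤ K * (|T| * s) := by
    intro f K hK
    rw [abs_norm] at hK
    have h0 : 0 ≤ K := (norm_nonneg f).trans hK.le
    calc |lam x * f v| = |lam x| * |f v| := abs_mul _ _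
      _ ≤ |lam x| * (K * ‖v‖) := by
        gcongr
        exact (f.le_opNorm v).trans (by gcongr)
      _ = K * (|lam x| * ‖v‖) := by ring
      _ ≤ K * (|T| * s) := by gcongr
  have e2 := hlin _ _ i5
  have e3 := hlin _ _ i6
  have e4 : |fderiv ℝ φ x v| ≤ ((|c x₀| + 1) * |B| + (|‖fderiv ℝ h x₀‖| + 1) * |T|) * s := by
    rw [hφ']
    simp only [add_apply, smul_apply, smul_eq_mul]
    refine (abs_add_le _ _).trans ?_
    linarith
  rw [hΨ]
  refine (abs_add_le _ _).trans ?_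
  have e5 : |2 * φ x * fderiv ℝ φ x v| ≤ 2 * (|φ x₀| + 1) *
      (((|c x₀| + 1) * |B| + (|‖fderiv ℝ h x₀‖| + 1) * |T|) * s) := by
    rw [abs_mul, abs_mul, abs_two]
    gcongr
  have e6 : |2 * (lam x * fderiv ℝ lam x v)| ≤ 2 * ((|‖fderiv ℝ lam x₀‖| + 1) * (|T| * s)) := by
    rw [abs_mul, abs_two]; gcongr
  calc _ ≤ _ := add_le_add e5 e6
    _ = _ := by ring

/-! ### Inequalities for binary quadratic forms -/

/-- The quadratic form `E v₀² + 2 F v₀ v₁ + G v₁²`. -/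
def quadForm (E F G : ℝ) (v : Plane) : ℝ := E * v 0 ^ 2 + 2 * F * v 0 * v 1 + G * v 1 ^ 2

lemma plane_norm_sq (v : Plane) : ‖v‖ ^ 2 = v 0 ^ 2 + v 1 ^ 2 := by
  simp [EuclideanSpace.norm_sq_eq]

/-- Cayley–Hamilton: for the Gram matrix `A`, `(tr A) A - (det A) I = A²`, so the difference of the
two sides is `‖A v‖²`. -/
lemma det_mul_norm_sq_le (E F G : ℝ) (v : Plane) :
    (E * G - F ^ 2) * ‖v‖ ^ 2 ≤ (E + G) * quadForm E F G v := by
  rw [plane_norm_sq, quadForm]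
  nlinarith [sq_nonneg (E * v 0 + F * v 1), sq_nonneg (F * v 0 + G * v 1)]

/-- Completing the square: `E Q(v) = (E v₀ + F v₁)² + (E G - F²) v₁²`. -/
lemma sq_planeForm_le_fst {E F G : ℝ} (hD : 0 ≤ E * G - F ^ 2) (v : Plane) :
    planeForm E F v ^ 2 ≤ E * quadForm E F G v := by
  rw [planeForm_apply, quadForm]
  nlinarith [mul_nonneg hD (sq_nonneg (v 1))]

lemma sq_planeForm_le_snd {E F G : ℝ} (hD : 0 ≤ E * G - F ^ 2) (v : Plane) :
    planeForm F G v ^ 2 ≤ G * quadForm E F G v := by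
  rw [planeForm_apply, quadForm]
  nlinarith [mul_nonneg hD (sq_nonneg (v 0))]

lemma mul_norm_le_of_sq_le_det {E F G l T : ℝ} (h0 : 0 ≤ E + G) (hT : E + G ≤ T)
    (hl : l ^ 2 ≤ E * G - F ^ 2) (hQ : ∀ v, 0 ≤ quadForm E F G v) (v : Plane) :
    |l| * ‖v‖ ≤ √T * √(quadForm E F G v) := by
  rw [← Real.sqrt_mul (h0.trans hT)]
  apply Real.le_sqrt_of_sq_le
  rw [mul_pow, sq_abs]
  calc l ^ 2 * ‖v‖ ^ 2 ≤ (E * G - F ^ 2) * ‖v‖ ^ 2 := by gcongr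
    _ ≤ (E + G) * quadForm E F G v := det_mul_norm_sq_le _ _ _ _
    _ ≤ _ := mul_le_mul_of_nonneg_right hT (hQ v)

/-! ### Barriers for a field of semi-definite matrices -/

section Barriers

variable {E F G : Plane → ℝ} {x₀ : Plane}

lemma exists_isBarrier_of_det_pos (hE : ContinuousAt E x₀) (hF : ContinuousAt F x₀)
    (hG : ContinuousAt G x₀) (hQ : ∀ᶠ x in 𝓝 x₀, ∀ v, 0 ≤ quadForm (E x) (F x) (G x) v)
    (hD : 0 < E x₀ * G x₀ - F x₀ ^ 2) :
    ∃ Ψ C, IsBarrier (fun x => quadForm (E x) (F x) (G x)) x₀ Ψ C := by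
  obtain ⟨δ, hδ, hδD⟩ := exists_between hD
  have h1 : ∀ᶠ x in 𝓝 x₀, δ < E x * G x - F x ^ 2 :=
    (continuousAt_const.eventually_lt ((hE.mul hG).sub (hF.pow 2)) hδD)
  have h2 : ∀ᶠ x in 𝓝 x₀, E x + G x < E x₀ + G x₀ + 1 :=
    (hE.add hG).eventually_lt continuousAt_const (lt_add_one (E x₀ + G x₀))
  refine ⟨fun x => ‖x - x₀‖ ^ 2, 2 * (√(E x₀ + G x₀ + 1) / √δ), by simp, ?_⟩
  filter_upwards [h1, h2, hQ, Metric.ball_mem_nhds x₀ one_pos] with x h1 h2 hQ hx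
  have hd : HasFDerivAt (fun x => ‖x - x₀‖ ^ 2) (2 • innerSL ℝ (x - x₀)) x := by
    simpa using ((hasFDerivAt_id x).sub_const x₀).norm_sq
  refine ⟨hd.differentiableAt, fun hne => by
    have := norm_pos_iff.2 (sub_ne_zero.2 hne); positivity, fun v => ?_⟩
  have hE0 : 0 ≤ E x := by simpa [quadForm] using hQ (EuclideanSpace.single 0 1)
  have hG0 : 0 ≤ G x := by simpa [quadForm] using hQ (EuclideanSpace.single 1 1)
  have h3 := mul_norm_le_of_sq_le_det (l := √δ) (add_nonneg hE0 hG0) h2.le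
    (by rw [Real.sq_sqrt hδ.le]; exact h1.le) hQ v
  rw [abs_of_nonneg (Real.sqrt_nonneg _)] at h3
  rw [mem_ball_iff_norm] at hx
  have hs : 0 < √δ := Real.sqrt_pos.2 hδ
  rw [hd.fderiv]
  simp only [smul_apply, innerSL_apply_apply, nsmul_eq_mul, abs_mul]
  calc _ ≤ 2 * (1 * ‖v‖) := by
        norm_num
        exact (abs_real_inner_le_norm _ _).trans
          (by nlinarith [norm_nonneg v])
    _ ≤ 2 * (√(E x₀ + G x₀ + 1) / √δ * √(quadForm (E x) (F x) (G x) v)) := by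
        refine mul_le_mul_of_nonneg_left ?_ zero_le_two
        rw [one_mul, div_mul_eq_mul_div, le_div_iff₀ hs]; linarith
    _ = _ := by ring

/-- A positive semi-definite matrix field whose determinant is a square `lam²` with `lam` having a
nondegenerate zero does not vanish at that zero. -/
lemma pos_or_pos_of_fderiv_ne_zero (hE : DifferentiableAt ℝ E x₀) (hG : DifferentiableAt ℝ G x₀)
    {lam : Plane → ℝ} (hlam₀ : lam x₀ = 0)
    (hdlam : fderiv ℝ lam x₀ ≠ 0) (hE0 : ∀ᶠ x in 𝓝 x₀, 0 ≤ E x) (hG0 : ∀ᶠ x in 𝓝 x₀, 0 ≤ G x)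
    (hD : ∀ᶠ x in 𝓝 x₀, E x * G x - F x ^ 2 = lam x ^ 2) : 0 < E x₀ ∨ 0 < G x₀ := by
  by_contra! hcon
  -- If both diagonal entries vanish at `x₀`, each has a local minimum there and is `o(‖x - x₀‖)`.
  -- Then `λ² ≤ E G` makes `λ` itself `o(‖x - x₀‖)`, so `dλ = 0`.
  have key : ∀ f : Plane → ℝ, DifferentiableAt ℝ f x₀ → (∀ᶠ x in 𝓝 x₀, 0 ≤ f x) → f x₀ ≤ 0 →
      f =o[𝓝 x₀] fun x => x - x₀ := by
    intro f hf h0 hle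
    have hz : f x₀ = 0 := le_antisymm hle h0.self_of_nhds
    have hmin : IsLocalMin f x₀ := h0.mono fun x hx => by rwa [hz]
    have h := hf.hasFDerivAt
    rw [hmin.fderiv_eq_zero] at h
    simpa [hz] using h.isLittleO
  have hEo := key E hE hE0 hcon.1
  have hGo := key G hG hG0 hcon.2
  refine hdlam (HasFDerivAt.fderiv ?_)
  rw [hasFDerivAt_iff_isLittleO]
  simp only [hlam₀, sub_zero, zero_apply]
  rw [Asymptotics.isLittleO_iff] at hEo hGo ⊢
  intro c hc
  filter_upwards [hEo hc, hGo hc, hE0, hG0, hD] with x h1 h2 h3 h4 h5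
  rw [Real.norm_of_nonneg h3] at h1
  rw [Real.norm_of_nonneg h4] at h2
  rw [Real.norm_eq_abs]
  apply abs_le_of_sq_le_sq _ (by positivity)
  nlinarith [mul_le_mul h1 h2 h4 (by positivity), sq_nonneg (F x)]

lemma exists_isBarrier_of_null_transversal (hE : ContDiffAt ℝ 1 E x₀) (hF : ContDiffAt ℝ 1 F x₀)
    (hG : ContDiffAt ℝ 1 G x₀) (hQ : ∀ᶠ x in 𝓝 x₀, ∀ v, 0 ≤ quadForm (E x) (F x) (G x) v)
    {lam : Plane → ℝ} (hlam : ContDiffAt ℝ 2 lam x₀)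
    (hD : ∀ᶠ x in 𝓝 x₀, E x * G x - F x ^ 2 = lam x ^ 2) {w : Plane}
    (hw1 : planeForm (E x₀) (F x₀) w = 0) (hw2 : planeForm (F x₀) (G x₀) w = 0)
    (hw : fderiv ℝ lam x₀ w ≠ 0) :
    ∃ Ψ C, IsBarrier (fun x => quadForm (E x) (F x) (G x)) x₀ Ψ C := by
  have hE0 : ∀ᶠ x in 𝓝 x₀, 0 ≤ E x :=
    hQ.mono fun x hx => by simpa [quadForm] using hx (EuclideanSpace.single 0 1)
  have hG0 : ∀ᶠ x in 𝓝 x₀, 0 ≤ G x :=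
    hQ.mono fun x hx => by simpa [quadForm] using hx (EuclideanSpace.single 1 1)
  have hw0 : w ≠ 0 := fun h => hw (by simp [h])
  -- The Gram matrix kills `w ≠ 0`, so its determinant `λ²` vanishes at `x₀`.
  have hlam₀ : lam x₀ = 0 := by
    have h1 := hD.self_of_nhds
    rw [planeForm_apply] at hw1 hw2
    have e0 : (E x₀ * G x₀ - F x₀ ^ 2) * w 0 = 0 := by linear_combination G x₀ * hw1 - F x₀ * hw2
    have e1 : (E x₀ * G x₀ - F x₀ ^ 2) * w 1 = 0 := by linear_combination E x₀ * hw2 - F x₀ * hw1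
    rw [h1] at e0 e1
    by_contra hne
    apply hw0
    have : lam x₀ ^ 2 ≠ 0 := pow_ne_zero 2 hne
    ext i; fin_cases i
    · simpa [this, hne] using e0
    · simpa [this, hne] using e1
  have hT : ∀ᶠ x in 𝓝 x₀, ∀ v, |lam x| * ‖v‖ ≤
      √(E x₀ + G x₀ + 1) * √(quadForm (E x) (F x) (G x) v) := by
    have h2 : ∀ᶠ x in 𝓝 x₀, E x + G x < E x₀ + G x₀ + 1 :=
      (hE.continuousAt.add hG.continuousAt).eventually_lt continuousAt_const
        (lt_add_one (E x₀ + G x₀))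
    filter_upwards [h2, hQ, hE0, hG0, hD] with x h2 hQ hE0 hG0 hD v
    exact mul_norm_le_of_sq_le_det (add_nonneg hE0 hG0) h2.le hD.ge hQ v
  have hbound : ∀ (b₀ b₁ A : Plane → ℝ), ContinuousAt A x₀ → (∀ᶠ x in 𝓝 x₀, 0 ≤ A x) →
      (∀ᶠ x in 𝓝 x₀, ∀ v, planeForm (b₀ x) (b₁ x) v ^ 2 ≤ A x * quadForm (E x) (F x) (G x) v) →
      ∀ᶠ x in 𝓝 x₀, ∀ v, |planeForm (b₀ x) (b₁ x) v| ≤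
        √(A x₀ + 1) * √(quadForm (E x) (F x) (G x) v) := by
    intro b₀ b₁ A hA hA0 hb
    filter_upwards [hA.eventually_lt continuousAt_const (lt_add_one (A x₀)), hA0, hb, hQ]
      with x h1 h2 h3 h4 v
    rw [← Real.sqrt_mul (h2.trans h1.le)]
    apply Real.abs_le_sqrt
    exact (h3 v).trans (mul_le_mul_of_nonneg_right h1.le (h4 v))
  -- A nonzero row that kills `w` has its kernel spanned by `w`, so transversality passes from `w`
  -- to `planeRot a b`.
  have hrot : ∀ a b : ℝ, planeForm a b w = 0 → (a ≠ 0 ∨ b ≠ 0) →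
      fderiv ℝ lam x₀ (planeRot a b) ≠ 0 := by
    intro a b hab hne h0
    rw [planeForm_apply] at hab
    have e : (w 0 ^ 2 + w 1 ^ 2) • planeRot a b = (a * w 1 - b * w 0) • w := by
      ext i; fin_cases i
      · simp; linear_combination (-w 1) * hab
      · simp; linear_combination (w 0) * hab
    have e2 := congrArg (fderiv ℝ lam x₀) e
    rw [map_smul, map_smul, h0, smul_zero, smul_eq_mul, eq_comm, mul_eq_zero] at e2
    have e3 : a * w 1 - b * w 0 = 0 := e2.resolve_right hw
    have hs : w 0 ^ 2 + w 1 ^ 2 ≠ 0 := by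
      rw [← plane_norm_sq]; exact pow_ne_zero 2 (norm_ne_zero_iff.2 hw0)
    have ha : a * (w 0 ^ 2 + w 1 ^ 2) = 0 := by linear_combination w 0 * hab + w 1 * e3
    have hb : b * (w 0 ^ 2 + w 1 ^ 2) = 0 := by linear_combination w 1 * hab - w 0 * e3
    rcases hne with h | h
    · exact h ((mul_eq_zero.1 ha).resolve_right hs)
    · exact h ((mul_eq_zero.1 hb).resolve_right hs)
  have hD0 : ∀ᶠ x in 𝓝 x₀, 0 ≤ E x * G x - F x ^ 2 :=
    hD.mono fun x hx => by rw [hx]; positivity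
  rcases pos_or_pos_of_fderiv_ne_zero (hE.differentiableAt (by norm_num))
    (hG.differentiableAt (by norm_num)) hlam₀
    (fun h => hw (by simp [h])) hE0 hG0 hD with h | h
  · exact exists_isBarrier_of_transversal _ E F lam x₀ hE hF hlam hlam₀ _ _
      (hbound E F E hE.continuousAt hE0 (hD0.mono fun x hx v => sq_planeForm_le_fst hx v)) hT
      (hrot _ _ hw1 (Or.inl h.ne'))
  · exact exists_isBarrier_of_transversal _ F G lam x₀ hF hG hlam hlam₀ _ _
      (hbound F G G hG.continuousAt hG0 (hD0.mono fun x hx v => sq_planeForm_le_snd hx v)) hT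
      (hrot _ _ hw2 (Or.inr h.ne'))

end Barriers

/-! ### The metric in a chart -/

namespace SemidefMetric

variable {r : ℕ∞ω} {M : Type*} [TopologicalSpace M] [ChartedSpace Plane M]
  [IsManifold (𝓡 2) ∞ M]

/-- If `V`, `W` are `C^n` vector fields along `c`, then `⟨V, W⟩` is `C^n`. -/
lemma contMDiffWithinAt_form (g : SemidefMetric r M) {n : ℕ∞ω} (hn : n ≤ r)
    {E' : Type*} [NormedAddCommGroup E'] [NormedSpace ℝ E'] {c : E' → M}
    {V W : Π y : E', TangentSpace (𝓡 2) (c y)} {s : Set E'} {y : E'}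
    (hV : ContMDiffWithinAt 𝓘(ℝ, E') (𝓡 2).tangent n
      (fun y ↦ (⟨c y, V y⟩ : TangentBundle (𝓡 2) M)) s y)
    (hW : ContMDiffWithinAt 𝓘(ℝ, E') (𝓡 2).tangent n
      (fun y ↦ (⟨c y, W y⟩ : TangentBundle (𝓡 2) M)) s y) :
    ContDiffWithinAt ℝ n (fun y ↦ g.form (c y) (V y) (W y)) s y := by
  have hc : ContMDiffWithinAt 𝓘(ℝ, E') (𝓡 2) n c s y := by
    simp only [Bundle.contMDiffWithinAt_totalSpace] at hV
    exact hV.1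
  have : ContMDiffWithinAt 𝓘(ℝ, E') ((𝓡 2).prod 𝓘(ℝ)) n
      (fun m ↦ Bundle.TotalSpace.mk' ℝ (E := Bundle.Trivial M ℝ) (c m)
        (g.form (c m) (V m) (W m))) s y := by
    apply ContMDiffWithinAt.clm_bundle_apply₂ (F₁ := Plane) (F₂ := Plane)
      (E₁ := fun x : M ↦ TangentSpace (𝓡 2) x) (E₂ := fun x : M ↦ TangentSpace (𝓡 2) x)
    · exact ContMDiffAt.comp_contMDiffWithinAt y (g.contMDiff.of_le hn).contMDiffAt hc
    · exact hV
    · exact hW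
  simp only [Bundle.contMDiffWithinAt_totalSpace] at this
  exact this.2.contDiffWithinAt

section Chart

variable {e : OpenPartialHomeomorph M Plane}

lemma contMDiffWithinAt_mfderiv_symm (he : e ∈ IsManifold.maximalAtlas (𝓡 2) ∞ M) (u : Plane)
    {x : Plane} (hx : x ∈ e.target) :
    ContMDiffWithinAt 𝓘(ℝ, Plane) (𝓡 2).tangent 1
      (fun y ↦ (⟨e.symm y, mfderiv 𝓘(ℝ, Plane) (𝓡 2) e.symm y u⟩ : TangentBundle (𝓡 2) M))
      e.target x := by
  have h1 := (contMDiffOn_symm_of_mem_maximalAtlas he).contMDiffOn_tangentMapWithin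
    (m := 1) (by norm_cast) e.open_target.uniqueMDiffOn
  have h2 : ContMDiffWithinAt 𝓘(ℝ, Plane) 𝓘(ℝ, Plane).tangent 1
      (fun y : Plane ↦ (⟨y, u⟩ : TangentBundle 𝓘(ℝ, Plane) Plane)) e.target x :=
    contMDiffWithinAt_vectorSpace_iff_contDiffWithinAt.2 contDiffWithinAt_const
  refine ((h1 ⟨x, u⟩ hx).comp x h2 (fun y hy => hy)).congr (fun y hy => ?_) ?_
  · simp [tangentMapWithin, mfderivWithin_of_isOpen e.open_target hy]
  · simp [tangentMapWithin, mfderivWithin_of_isOpen e.open_target hx]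

lemma contDiffAt_coeff (g : SemidefMetric r M) (hr : 1 ≤ r)
    (he : e ∈ IsManifold.maximalAtlas (𝓡 2) ∞ M) (i j : Fin 2) {x : Plane} (hx : x ∈ e.target) :
    ContDiffAt ℝ 1 (g.coeff e i j) x :=
  (g.contMDiffWithinAt_form hr (contMDiffWithinAt_mfderiv_symm he _ hx)
    (contMDiffWithinAt_mfderiv_symm he _ hx)).contDiffAt (e.open_target.mem_nhds hx)

/-- The quadratic form of the metric in the chart `e`. -/
def chartQuad (g : SemidefMetric r M) (e : OpenPartialHomeomorph M Plane) (x : Plane) :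
    Plane → ℝ :=
  quadForm (g.coeff e 0 0 x) (g.coeff e 0 1 x) (g.coeff e 1 1 x)

lemma mfderiv_symm_eq (e : OpenPartialHomeomorph M Plane) (x v : Plane) :
    mfderiv 𝓘(ℝ, Plane) (𝓡 2) e.symm x v = v 0 • coordVec e 0 x + v 1 • coordVec e 1 x := by
  conv_lhs => rw [plane_vec_eq v]
  erw [map_add, map_smul, map_smul]
  rfl

lemma coeff_comm (g : SemidefMetric r M) (i j : Fin 2) (x : Plane) :
    g.coeff e i j x = g.coeff e j i x := g.symm _ _ _

lemma form_mfderiv_symm_self (g : SemidefMetric r M) (x v : Plane) :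
    g.form (e.symm x) (mfderiv 𝓘(ℝ, Plane) (𝓡 2) e.symm x v)
      (mfderiv 𝓘(ℝ, Plane) (𝓡 2) e.symm x v) = g.chartQuad e x v := by
  have h := g.coeff_comm (e := e) 1 0 x
  rw [mfderiv_symm_eq]
  simp only [map_add, map_smul, add_apply, smul_apply, smul_eq_mul, chartQuad, quadForm]
  simp only [coeff] at h ⊢
  linear_combination (v 0 * v 1) * h

lemma form_mfderiv_symm_coordVec (g : SemidefMetric r M) (x v : Plane) (i : Fin 2) :
    g.form (e.symm x) (mfderiv 𝓘(ℝ, Plane) (𝓡 2) e.symm x v) (coordVec e i x) =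
      planeForm (g.coeff e i 0 x) (g.coeff e i 1 x) v := by
  rw [mfderiv_symm_eq, g.coeff_comm i 0, g.coeff_comm i 1]
  simp only [map_add, map_smul, add_apply, smul_apply, smul_eq_mul, planeForm_apply, coeff]
  ring

lemma chartQuad_nonneg (g : SemidefMetric r M) (x v : Plane) : 0 ≤ g.chartQuad e x v := by
  rw [← form_mfderiv_symm_self]; exact g.nonneg _ _

/-- The Gram determinant `EG - F²` in the chart `e`. -/
def chartDet (g : SemidefMetric r M) (e : OpenPartialHomeomorph M Plane) (x : Plane) : ℝ :=
  g.coeff e 0 0 x * g.coeff e 1 1 x - g.coeff e 0 1 x ^ 2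

lemma chartDet_nonneg (g : SemidefMetric r M) (x : Plane) : 0 ≤ g.chartDet e x := by
  have h0 : 0 ≤ g.coeff e 0 0 x := g.nonneg _ _
  have h1 := g.chartQuad_nonneg (e := e) x
    (planeRot (g.coeff e 0 0 x) (g.coeff e 0 1 x))
  simp only [chartQuad, quadForm, planeRot_zero, planeRot_one] at h1
  rcases h0.eq_or_lt with h | h
  · have h2 := g.chartQuad_nonneg (e := e) x
      (planeRot (g.coeff e 0 1 x) ((g.coeff e 1 1 x + 1)))
    simp only [chartQuad, quadForm, planeRot_zero, planeRot_one, ← h] at h2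
    have h3 : 0 ≤ g.coeff e 1 1 x := g.nonneg _ _
    simp only [chartDet, ← h]
    nlinarith
  · have : 0 ≤ g.coeff e 0 0 x * g.chartDet e x := by simp only [chartDet]; nlinarith
    exact nonneg_of_mul_nonneg_right this h

lemma mdifferentiable_of_mem_maximalAtlas (he : e ∈ IsManifold.maximalAtlas (𝓡 2) ∞ M) :
    e.MDifferentiable (𝓡 2) (𝓡 2) :=
  ⟨(contMDiffOn_of_mem_maximalAtlas he).mdifferentiableOn (by simp),
    (contMDiffOn_symm_of_mem_maximalAtlas he).mdifferentiableOn (by simp)⟩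

lemma exists_mfderiv_symm_eq (he : e ∈ IsManifold.maximalAtlas (𝓡 2) ∞ M) {x : Plane}
    (hx : x ∈ e.target) (v : TangentSpace (𝓡 2) (e.symm x)) :
    ∃ w : Plane, mfderiv 𝓘(ℝ, Plane) (𝓡 2) e.symm x w = v :=
  (mdifferentiable_of_mem_maximalAtlas he).symm.mfderiv_surjective hx v

lemma chartDet_eq_zero_of_isSemidefPoint (g : SemidefMetric r M)
    (he : e ∈ IsManifold.maximalAtlas (𝓡 2) ∞ M) {x : Plane} (hx : x ∈ e.target)
    (h : g.IsSemidefPoint (e.symm x)) : g.chartDet e x = 0 := by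
  simp only [IsSemidefPoint] at h
  push Not at h
  obtain ⟨v, hv0, hv⟩ := h
  obtain ⟨w, rfl⟩ := exists_mfderiv_symm_eq he hx v
  have hw0 : w ≠ 0 := by
    rintro rfl
    exact hv0 (map_zero _)
  rw [form_mfderiv_symm_self] at hv
  have h1 : g.chartQuad e x w = 0 := le_antisymm hv (g.chartQuad_nonneg x w)
  have h2 := det_mul_norm_sq_le (g.coeff e 0 0 x) (g.coeff e 0 1 x) (g.coeff e 1 1 x) w
  change g.chartDet e x * ‖w‖ ^ 2 ≤ _ * g.chartQuad e x w at h2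
  rw [h1, mul_zero] at h2
  have h3 : 0 < ‖w‖ ^ 2 := by positivity
  exact le_antisymm (nonpos_of_mul_nonpos_left h2 h3) (g.chartDet_nonneg x)

lemma chartDet_pos_of_not_isSemidefPoint (g : SemidefMetric r M)
    (he : e ∈ IsManifold.maximalAtlas (𝓡 2) ∞ M) {x : Plane} (hx : x ∈ e.target)
    (h : ¬ g.IsSemidefPoint (e.symm x)) : 0 < g.chartDet e x := by
  simp only [IsSemidefPoint, not_not] at h
  have h' : ∀ w : Plane, w ≠ 0 → 0 < g.chartQuad e x w := by
    intro w hw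
    rw [← form_mfderiv_symm_self]
    refine h _ fun h0 => hw ?_
    exact (mdifferentiable_of_mem_maximalAtlas he).symm.mfderiv_injective hx
      (h0.trans (map_zero _).symm)
  have h0 : 0 < g.coeff e 0 0 x := by
    simpa [chartQuad, quadForm] using h' (EuclideanSpace.single 0 1) (by simp)
  have h1 := h' (planeRot (g.coeff e 0 0 x) (g.coeff e 0 1 x)) fun h => by
    have := congrArg (fun v : Plane => v 1) h
    simp at this
    exact h0.ne' this
  simp only [chartQuad, quadForm, planeRot_zero, planeRot_one] at h1
  have : 0 < g.coeff e 0 0 x * g.chartDet e x := by simp only [chartDet]; nlinarith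
  exact pos_of_mul_pos_right this h0.le

/-- All tangent spaces are the same model `Plane`; taking `v` and `w` there allows the base point to
be rewritten without transport. -/
lemma form_congr (g : SemidefMetric r M) {p q : M} (h : p = q) (v w : Plane) :
    g.form p v w = g.form q v w := by
  subst h; rfl

lemma velocity_congr {γ γ' : ℝ → M} {t : ℝ} (h : γ =ᶠ[𝓝 t] γ') :
    (velocity γ t : Plane) = velocity γ' t := by
  unfold velocity
  exact congrArg (fun f : ℝ →L[ℝ] Plane => f 1) h.mfderiv_eq

lemma velocity_comp_symm (c : ℝ → Plane) {t : ℝ} (hc : DifferentiableAt ℝ c t)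
    (he : MDifferentiableAt 𝓘(ℝ, Plane) (𝓡 2) e.symm (c t)) :
    velocity (e.symm ∘ c) t = mfderiv 𝓘(ℝ, Plane) (𝓡 2) e.symm (c t) (deriv c t) := by
  unfold velocity
  rw [mfderiv_comp t he hc.mdifferentiableAt]
  change mfderiv 𝓘(ℝ, Plane) (𝓡 2) e.symm (c t) (mfderiv 𝓘(ℝ, ℝ) 𝓘(ℝ, Plane) c t 1) = _
  rw [mfderiv_eq_fderiv]
  rfl

lemma eventuallyEq_symm_comp {γ : ℝ → M} {t : ℝ} (hγ : ContinuousAt γ t)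
    (ht : γ t ∈ e.source) : γ =ᶠ[𝓝 t] e.symm ∘ (e ∘ γ) := by
  filter_upwards [hγ.preimage_mem_nhds (e.open_source.mem_nhds ht)] with s hs
  exact (e.left_inv hs).symm

lemma differentiableAt_chart_comp (he : e ∈ IsManifold.maximalAtlas (𝓡 2) ∞ M) {γ : ℝ → M}
    {t : ℝ} (hγ : MDifferentiableAt 𝓘(ℝ, ℝ) (𝓡 2) γ t) (ht : γ t ∈ e.source) :
    DifferentiableAt ℝ (e ∘ γ) t :=
  (((mdifferentiable_of_mem_maximalAtlas he).mdifferentiableAt ht).comp t hγ).differentiableAt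

lemma velocity_eq_mfderiv_symm (he : e ∈ IsManifold.maximalAtlas (𝓡 2) ∞ M) {γ : ℝ → M} {t : ℝ}
    (hγ : MDifferentiableAt 𝓘(ℝ, ℝ) (𝓡 2) γ t) (ht : γ t ∈ e.source) :
    (velocity γ t : Plane) = mfderiv 𝓘(ℝ, Plane) (𝓡 2) e.symm (e (γ t)) (deriv (e ∘ γ) t) := by
  rw [velocity_congr (eventuallyEq_symm_comp hγ.continuousAt ht)]
  exact velocity_comp_symm (e ∘ γ) (differentiableAt_chart_comp he hγ ht)
    ((mdifferentiable_of_mem_maximalAtlas he).mdifferentiableAt_symm (e.map_source ht))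

lemma form_velocity_self_eq_chartQuad (g : SemidefMetric r M)
    (he : e ∈ IsManifold.maximalAtlas (𝓡 2) ∞ M) {γ : ℝ → M} {t : ℝ}
    (hγ : MDifferentiableAt 𝓘(ℝ, ℝ) (𝓡 2) γ t) (ht : γ t ∈ e.source) :
    g.form (γ t) (velocity γ t) (velocity γ t) =
      g.chartQuad e (e (γ t)) (deriv (e ∘ γ) t) := by
  rw [← form_mfderiv_symm_self]
  refine (g.form_congr (e.left_inv ht).symm _ _).trans ?_
  have h := velocity_eq_mfderiv_symm he hγ ht
  exact congrArg (fun v : Plane => g.form (e.symm (e (γ t))) v v) h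

/-- At a point where it is positive definite, the metric has a local barrier. -/
lemma exists_isBarrier_of_not_isSemidefPoint (g : SemidefMetric r M) (hr : 1 ≤ r)
    (he : e ∈ IsManifold.maximalAtlas (𝓡 2) ∞ M) {x : Plane} (hx : x ∈ e.target)
    (h : ¬ g.IsSemidefPoint (e.symm x)) : ∃ Ψ C, IsBarrier (g.chartQuad e) x Ψ C :=
  exists_isBarrier_of_det_pos (g.contDiffAt_coeff hr he 0 0 hx).continuousAt
    (g.contDiffAt_coeff hr he 0 1 hx).continuousAt (g.contDiffAt_coeff hr he 1 1 hx).continuousAt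
    (Eventually.of_forall fun y v => g.chartQuad_nonneg y v)
    (g.chartDet_pos_of_not_isSemidefPoint he hx h)

/-- A Kossowski metric has a local barrier at each point of type `A₂`. -/
lemma exists_isBarrier_of_isA2Point (g : SemidefMetric r M) (hr : 2 ≤ r)
    (he : e ∈ IsManifold.maximalAtlas (𝓡 2) ∞ M) {q : M} (hq : q ∈ e.source)
    (h : g.IsA2Point q) {lam : Plane → ℝ} (hlam : ContDiffOn ℝ r lam e.target)
    (hD : ∀ x ∈ e.target, g.coeff e 0 0 x * g.coeff e 1 1 x - g.coeff e 0 1 x ^ 2 = lam x ^ 2)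
    (hdlam : fderiv ℝ lam (e q) ≠ 0) : ∃ Ψ C, IsBarrier (g.chartQuad e) (e q) Ψ C := by
  obtain ⟨-, ε, σ, hσ, η, hη, hind⟩ := h
  obtain rfl := hσ.map_zero
  have hx := e.map_source hq
  have hr1 : 1 ≤ r := le_trans (by norm_num) hr
  have hnhds : Ioo (-ε) ε ∈ 𝓝 (0 : ℝ) := Ioo_mem_nhds (by linarith [hσ.pos]) hσ.pos
  have hσd : MDifferentiableAt 𝓘(ℝ, ℝ) (𝓡 2) σ 0 :=
    ((hσ.contMDiffOn.of_le hr1).contMDiffAt hnhds).mdifferentiableAt (by norm_num)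
  have hlamC : ContDiffAt ℝ 2 lam (e (σ 0)) :=
    (hlam.contDiffAt (e.open_target.mem_nhds hx)).of_le hr
  have hcd := differentiableAt_chart_comp he hσd hq
  obtain ⟨U, hU, hpU, himg⟩ := hσ.image_eq
  -- Every `σ t` is semi-definite, so `λ² = det = 0` along the curve, and `dλ` kills its velocity.
  have hlamσ : (fun t => lam (e (σ t))) =ᶠ[𝓝 0] fun _ => 0 := by
    filter_upwards [hnhds, hσd.continuousAt.preimage_mem_nhds (e.open_source.mem_nhds hq)]
      with t ht hts
    have hsd : g.IsSemidefPoint (σ t) := (himg.subset (mem_image_of_mem σ ht)).2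
    have h0 := g.chartDet_eq_zero_of_isSemidefPoint he (e.map_source hts)
      (by rwa [e.left_inv hts])
    rw [chartDet, hD _ (e.map_source hts)] at h0
    exact pow_eq_zero_iff two_ne_zero |>.1 h0
  have hlamv : fderiv ℝ lam (e (σ 0)) (deriv (e ∘ σ) 0) = 0 := by
    have h1 := ((hlamC.differentiableAt (by norm_num)).hasFDerivAt (x := (e ∘ σ) 0)).comp_hasDerivAt
      (0 : ℝ) hcd.hasDerivAt
    exact h1.unique ((hasDerivAt_const (0 : ℝ) (0 : ℝ)).congr_of_eventuallyEq hlamσ)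
  set B : Plane →L[ℝ] Plane := mfderiv 𝓘(ℝ, Plane) (𝓡 2) e.symm (e (σ 0)) with hB
  obtain ⟨w, hw⟩ : ∃ w : Plane, B w = (η : Plane) := exists_mfderiv_symm_eq he hx η
  have hv : (velocity σ 0 : Plane) = B (deriv (e ∘ σ) 0) := velocity_eq_mfderiv_symm he hσd hq
  have hpf : ∀ i, planeForm (g.coeff e i 0 (e (σ 0))) (g.coeff e i 1 (e (σ 0))) w = 0 := by
    intro i
    rw [← form_mfderiv_symm_coordVec]
    refine Eq.trans ?_ (hη (coordVec e i (e (σ 0)) : Plane))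
    refine Eq.trans ?_ (g.form_congr (e.left_inv hq) (η : Plane) (coordVec e i (e (σ 0)) : Plane))
    exact congrArg (fun v : Plane => g.form (e.symm (e (σ 0))) v (coordVec e i (e (σ 0)))) hw
  refine exists_isBarrier_of_null_transversal (g.contDiffAt_coeff hr1 he 0 0 hx)
    (g.contDiffAt_coeff hr1 he 0 1 hx) (g.contDiffAt_coeff hr1 he 1 1 hx)
    (Eventually.of_forall fun y v => g.chartQuad_nonneg y v) hlamC
    (by filter_upwards [e.open_target.mem_nhds hx] with y hy using hD y hy) (w := w)
    (hpf 0) (by rw [g.coeff_comm 0 1]; exact hpf 1) fun hlw => ?_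
  -- the velocity and the null vector would both lie in the kernel of `dλ`
  set c' := deriv (e ∘ σ) 0
  have hind' : LinearIndependent ℝ ![c', w] := by
    have h1 : LinearIndependent ℝ (B ∘ ![c', w]) := by
      have h2 : B ∘ ![c', w] = ![B c', B w] := by ext i : 1; fin_cases i <;> rfl
      rw [h2, hw, ← hv]
      exact hind
    exact LinearIndependent.of_comp B.toLinearMap h1
  apply hdlam
  have hspan := hind'.span_eq_top_of_card_eq_finrank (by simp)
  have hker : Submodule.span ℝ (range ![c', w]) ≤ (fderiv ℝ lam (e (σ 0))).toLinearMap.ker := by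
    rw [Submodule.span_le]
    rintro _ ⟨i, rfl⟩
    fin_cases i
    · exact hlamv
    · exact hlw
  ext v
  exact hker (hspan ▸ Submodule.mem_top)

end Chart

/-! ### Speed and arc length -/

/-- The speed of a curve with respect to the metric. -/
def speed (g : SemidefMetric r M) (γ : ℝ → M) (t : ℝ) : ℝ :=
  √(g.form (γ t) (velocity γ t) (velocity γ t))

lemma speed_nonneg (g : SemidefMetric r M) (γ : ℝ → M) (t : ℝ) : 0 ≤ g.speed γ t :=
  Real.sqrt_nonneg _

lemma arcLength_eq (g : SemidefMetric r M) (γ : ℝ → M) (a b : ℝ) :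
    g.arcLength γ a b = ∫ t in a..b, g.speed γ t := rfl

lemma speed_congr (g : SemidefMetric r M) {γ γ' : ℝ → M} {t : ℝ} (h : γ =ᶠ[𝓝 t] γ') :
    g.speed γ t = g.speed γ' t := by
  unfold speed
  congr 1
  refine (g.form_congr h.eq_of_nhds _ _).trans ?_
  exact congrArg (fun v : Plane => g.form (γ' t) v v) (velocity_congr h)

/-- The condition `k * k = 1` covers `k = 1` (translation) and `k = -1` (reversal), the two
reparametrizations needed to join and reverse arcs. -/
lemma speed_comp_affine (g : SemidefMetric r M) (γ : ℝ → M) {k : ℝ} (hk : k * k = 1) (c t : ℝ) :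
    g.speed (fun s => γ (k * s + c)) t = g.speed γ (k * t + c) := by
  have haff : ∀ (c t : ℝ), HasDerivAt (fun s : ℝ => k * s + c) k t := fun c t => by
    simpa using ((hasDerivAt_id t).const_mul k).add_const c
  have hinv : γ = (fun s => γ (k * s + c)) ∘ fun s => k * s + -(k * c) := by
    ext s
    simp only [Function.comp]
    congr 1
    linear_combination (c - s) * hk
  have key : (velocity (fun s => γ (k * s + c)) t : Plane) =
      k • (velocity γ (k * t + c) : Plane) := by
    unfold velocity
    by_cases h : MDifferentiableAt 𝓘(ℝ, ℝ) (𝓡 2) γ (k * t + c)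
    · have h1 := mfderiv_comp t (f := fun s : ℝ => k * s + c) h
        (haff c t).differentiableAt.mdifferentiableAt
      have h2 : mfderiv 𝓘(ℝ, ℝ) 𝓘(ℝ, ℝ) (fun s : ℝ => k * s + c) t (1 : ℝ) = k := by
        rw [mfderiv_eq_fderiv]
        exact (haff c t).deriv
      have h3 := congrArg (fun f : ℝ →L[ℝ] Plane => f 1) h1
      refine Eq.trans h3 ?_
      change mfderiv 𝓘(ℝ, ℝ) (𝓡 2) γ (k * t + c)
        (mfderiv 𝓘(ℝ, ℝ) 𝓘(ℝ, ℝ) (fun s : ℝ => k * s + c) t (1 : ℝ)) = _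
      rw [h2]
      have h4 : ∀ A : ℝ →L[ℝ] Plane, A k = k • A 1 := fun A => by
        rw [← map_smul, smul_eq_mul, mul_one]
      exact h4 _
    · have h' : ¬ MDifferentiableAt 𝓘(ℝ, ℝ) (𝓡 2) (fun s => γ (k * s + c)) t := by
        intro h'
        apply h
        rw [hinv]
        refine MDifferentiableAt.comp (I' := 𝓘(ℝ, ℝ)) _ ?_
          (haff _ _).differentiableAt.mdifferentiableAt
        convert h' using 1
        linear_combination t * hk
      rw [mfderiv_zero_of_not_mdifferentiableAt h, mfderiv_zero_of_not_mdifferentiableAt h']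
      exact (smul_zero k).symm
  unfold speed
  congr 1
  have h5 := congrArg (fun v : Plane => g.form (γ (k * t + c)) v v) key
  refine Eq.trans h5 ?_
  simp only [map_smul, smul_apply, smul_eq_mul]
  rw [← mul_assoc, hk, one_mul]

namespace IsPiecewiseSmooth

variable {γ γ' : ℝ → M} {a b c : ℝ}

lemma le (h : IsPiecewiseSmooth γ a b) : a ≤ b := by
  induction h with
  | smooth hab _ => exact hab
  | append _ _ h1 h2 => exact h1.trans h2

lemma continuousOn (h : IsPiecewiseSmooth γ a b) : ContinuousOn γ (Icc a b) := by
  induction h with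
  | smooth _ h => exact h.continuousOn
  | append h h' h1 h2 =>
    rw [← Icc_union_Icc_eq_Icc h.le h'.le]
    exact h1.union_of_isClosed h2 isClosed_Icc isClosed_Icc

lemma congr (h : IsPiecewiseSmooth γ a b) (heq : EqOn γ' γ (Icc a b)) :
    IsPiecewiseSmooth γ' a b := by
  induction h with
  | smooth hab h => exact .smooth hab (h.congr heq)
  | append h h' h1 h2 =>
    exact .append (h1 (heq.mono (Icc_subset_Icc_right h'.le)))
      (h2 (heq.mono (Icc_subset_Icc_left h.le)))

lemma left_part (h : IsPiecewiseSmooth γ a b) (hc : c ∈ Icc a b) : IsPiecewiseSmooth γ a c := by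
  induction h with
  | smooth hab h => exact .smooth hc.1 (h.mono (Icc_subset_Icc_right hc.2))
  | @append a b d h h' h1 h2 =>
    rcases le_total c b with hcb | hcb
    · exact h1 ⟨hc.1, hcb⟩
    · exact .append h (h2 ⟨hcb, hc.2⟩)

lemma translate (h : IsPiecewiseSmooth γ a b) (c : ℝ) :
    IsPiecewiseSmooth (fun t => γ (1 * t + c)) (a - c) (b - c) := by
  induction h with
  | smooth hab h =>
    refine .smooth (by linarith) (h.comp (ContDiff.contMDiff (by fun_prop)).contMDiffOn ?_)
    intro t ht
    exact ⟨by linarith [ht.1], by linarith [ht.2]⟩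
  | append _ _ h1 h2 => exact .append h1 h2

lemma reverse (h : IsPiecewiseSmooth γ a b) :
    IsPiecewiseSmooth (fun t => γ (-1 * t + 0)) (-b) (-a) := by
  induction h with
  | smooth hab h =>
    refine .smooth (by linarith) (h.comp (ContDiff.contMDiff (by fun_prop)).contMDiffOn ?_)
    intro t ht
    exact ⟨by linarith [ht.2], by linarith [ht.1]⟩
  | append _ _ h1 h2 => exact .append h2 h1

lemma intervalIntegrable_speed (h : IsPiecewiseSmooth γ a b) (g : SemidefMetric r M) :
    IntervalIntegrable (g.speed γ) MeasureTheory.volume a b := by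
  induction h with
  | append _ _ h1 h2 => exact h1.trans h2
  | @smooth a b hab h =>
    rcases hab.eq_or_lt with rfl | hlt
    · exact IntervalIntegrable.refl
    have h1 := (h.contMDiffOn_tangentMapWithin (m := 0) (by simp)
      (uniqueDiffOn_Icc hlt).uniqueMDiffOn)
    have h2 : ∀ t ∈ Icc a b, ContMDiffWithinAt 𝓘(ℝ, ℝ) (𝓡 2).tangent 0 (fun t ↦
        (⟨γ t, mfderivWithin 𝓘(ℝ, ℝ) (𝓡 2) γ (Icc a b) t (1 : ℝ)⟩ : TangentBundle (𝓡 2) M))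
        (Icc a b) t := by
      intro t ht
      have h3 : ContMDiffWithinAt 𝓘(ℝ, ℝ) 𝓘(ℝ, ℝ).tangent 0
          (fun y : ℝ ↦ (⟨y, (1 : ℝ)⟩ : TangentBundle 𝓘(ℝ, ℝ) ℝ)) (Icc a b) t :=
        contMDiffWithinAt_vectorSpace_iff_contDiffWithinAt.2 contDiffWithinAt_const
      exact (h1 ⟨t, (1 : ℝ)⟩ ht).comp t h3 (fun y hy => hy)
    -- The speed computed from one-sided derivatives is continuous on the closed interval and agrees
    -- with `speed` in its interior; values of `speed` at the endpoints do not affect the integral.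
    have h4 : ContinuousOn (fun t => √(g.form (γ t)
        (mfderivWithin 𝓘(ℝ, ℝ) (𝓡 2) γ (Icc a b) t (1 : ℝ))
        (mfderivWithin 𝓘(ℝ, ℝ) (𝓡 2) γ (Icc a b) t (1 : ℝ)))) (Icc a b) := fun t ht =>
      (g.contMDiffWithinAt_form (by simp) (h2 t ht) (h2 t ht)).continuousWithinAt.sqrt
    rw [intervalIntegrable_iff_integrableOn_Ioo_of_le hab]
    refine ((h4.integrableOn_Icc (μ := MeasureTheory.volume)).mono_set
      Ioo_subset_Icc_self).congr_fun (fun t ht => ?_) measurableSet_Ioo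
    have h5 := mfderivWithin_of_mem_nhds (I := 𝓘(ℝ, ℝ)) (I' := 𝓡 2) (f := γ)
      (Icc_mem_nhds ht.1 ht.2)
    simp only [h5]
    rfl

end IsPiecewiseSmooth

section Length

variable {γ γ' : ℝ → M} {a b c : ℝ} (g : SemidefMetric r M)

lemma arcLength_nonneg (γ : ℝ → M) (hab : a ≤ b) : 0 ≤ g.arcLength γ a b :=
  intervalIntegral.integral_nonneg hab fun _ _ => Real.sqrt_nonneg _

lemma arcLength_add (h : IsPiecewiseSmooth γ a b) (h' : IsPiecewiseSmooth γ b c) :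
    g.arcLength γ a b + g.arcLength γ b c = g.arcLength γ a c :=
  intervalIntegral.integral_add_adjacent_intervals (h.intervalIntegrable_speed g)
    (h'.intervalIntegrable_speed g)

lemma arcLength_mono (h : IsPiecewiseSmooth γ a b) (hc : c ∈ Icc a b) :
    g.arcLength γ a c ≤ g.arcLength γ a b := by
  refine intervalIntegral.integral_mono_interval le_rfl hc.1 hc.2 ?_
    (h.intervalIntegrable_speed g)
  exact Eventually.of_forall fun _ => Real.sqrt_nonneg _

lemma arcLength_congr (hab : a ≤ b) (h : EqOn γ γ' (Ioo a b)) :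
    g.arcLength γ a b = g.arcLength γ' a b := by
  rw [arcLength_eq, arcLength_eq, intervalIntegral.integral_of_le hab,
    intervalIntegral.integral_of_le hab, MeasureTheory.integral_Ioc_eq_integral_Ioo,
    MeasureTheory.integral_Ioc_eq_integral_Ioo]
  refine MeasureTheory.setIntegral_congr_fun measurableSet_Ioo fun t ht => ?_
  exact g.speed_congr (h.eventuallyEq_of_mem (Ioo_mem_nhds ht.1 ht.2))

lemma arcLength_translate (γ : ℝ → M) (a b c : ℝ) :
    g.arcLength (fun t => γ (1 * t + c)) (a - c) (b - c) = g.arcLength γ a b := by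
  simp only [arcLength_eq, g.speed_comp_affine γ (one_mul 1)]
  simp only [one_mul, intervalIntegral.integral_comp_add_right, sub_add_cancel]

lemma arcLength_reverse (γ : ℝ → M) (a b : ℝ) :
    g.arcLength (fun t => γ (-1 * t + 0)) (-b) (-a) = g.arcLength γ a b := by
  simp only [arcLength_eq, g.speed_comp_affine γ (show (-1 : ℝ) * -1 = 1 by norm_num)]
  simp

/-- A function whose differential is controlled by the metric varies along a curve by at most a
multiple of the length of the curve. -/
lemma sub_le_mul_arcLength (h : IsPiecewiseSmooth γ a b) {e : OpenPartialHomeomorph M Plane}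
    (he : e ∈ IsManifold.maximalAtlas (𝓡 2) ∞ M) (hsrc : ∀ t ∈ Icc a b, γ t ∈ e.source)
    {Ψ : Plane → ℝ} {C : ℝ} (hΨ : ∀ t ∈ Icc a b, DifferentiableAt ℝ Ψ (e (γ t)))
    (hC : ∀ t ∈ Icc a b, ∀ v, |fderiv ℝ Ψ (e (γ t)) v| ≤ C * √(g.chartQuad e (e (γ t)) v)) :
    Ψ (e (γ b)) - Ψ (e (γ a)) ≤ C * g.arcLength γ a b := by
  induction h with
  | @append a b c h h' h1 h2 =>
    have s1 : Icc a b ⊆ Icc a c := Icc_subset_Icc_right h'.le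
    have s2 : Icc b c ⊆ Icc a c := Icc_subset_Icc_left h.le
    have e1 := h1 (fun t ht => hsrc t (s1 ht)) (fun t ht => hΨ t (s1 ht)) fun t ht => hC t (s1 ht)
    have e2 := h2 (fun t ht => hsrc t (s2 ht)) (fun t ht => hΨ t (s2 ht)) fun t ht => hC t (s2 ht)
    rw [← g.arcLength_add h h']
    linarith
  | @smooth a b hab h =>
    rw [arcLength_eq, ← intervalIntegral.integral_const_mul]
    have hint := ((IsPiecewiseSmooth.smooth hab h).intervalIntegrable_speed g).const_mul C
    rw [intervalIntegrable_iff_integrableOn_Icc_of_le hab] at hint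
    have hmd : ∀ t ∈ Ioo a b, MDifferentiableAt 𝓘(ℝ, ℝ) (𝓡 2) γ t := fun t ht =>
      (h.contMDiffAt (Icc_mem_nhds ht.1 ht.2)).mdifferentiableAt (by simp)
    refine intervalIntegral.sub_le_integral_of_hasDeriv_right_of_le hab
      (g := fun t => Ψ (e (γ t))) (g' := fun t => fderiv ℝ Ψ (e (γ t)) (deriv (e ∘ γ) t))
      (fun t ht => ?_) (fun t ht => ?_) hint (fun t ht => ?_)
    · exact (hΨ t ht).continuousAt.comp_continuousWithinAt (f := e ∘ γ)
        ((e.continuousAt (hsrc t ht)).comp_continuousWithinAt (h.continuousOn t ht))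
    · have hti := Ioo_subset_Icc_self ht
      exact (((hΨ t hti).hasFDerivAt (x := (e ∘ γ) t)).comp_hasDerivAt t
        (differentiableAt_chart_comp he (hmd t ht) (hsrc t hti)).hasDerivAt).hasDerivWithinAt
    · have hti := Ioo_subset_Icc_self ht
      refine (le_abs_self _).trans ((hC t hti _).trans_eq ?_)
      rw [speed, g.form_velocity_self_eq_chartQuad he (hmd t ht) (hsrc t hti)]

end Length

/-! ### The pre-distance -/

/-- `L` is the length of a piecewise smooth arc from `p` to `q`. -/
def HasArc (g : SemidefMetric r M) (p q : M) (L : ℝ) : Prop :=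
  ∃ (a b : ℝ) (γ : ℝ → M), IsPiecewiseSmooth γ a b ∧ γ a = p ∧ γ b = q ∧ L = g.arcLength γ a b

variable {g : SemidefMetric r M} {p q q' : M} {L L' : ℝ}

lemma HasArc.nonneg (h : g.HasArc p q L) : 0 ≤ L := by
  obtain ⟨a, b, γ, hγ, -, -, rfl⟩ := h
  exact g.arcLength_nonneg γ hγ.le

lemma HasArc.refl (g : SemidefMetric r M) (p : M) : g.HasArc p p 0 :=
  ⟨0, 0, fun _ => p, .smooth le_rfl contMDiffOn_const, rfl, rfl, by simp [arcLength]⟩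

lemma HasArc.symm (h : g.HasArc p q L) : g.HasArc q p L := by
  obtain ⟨a, b, γ, hγ, ha, hb, rfl⟩ := h
  exact ⟨-b, -a, _, hγ.reverse, by simpa using hb, by simpa using ha,
    (g.arcLength_reverse γ a b).symm⟩

lemma HasArc.trans (h : g.HasArc p q L) (h' : g.HasArc q q' L') : g.HasArc p q' (L + L') := by
  obtain ⟨a, b, γ, hγ, ha, hb, rfl⟩ := h
  obtain ⟨a', b', γ', hγ', ha', hb', rfl⟩ := h'
  set d := a' - b with hd
  have ht := hγ'.translate d
  have hab := hγ.le
  have hab' := ht.le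
  rw [show a' - d = b by simp [hd]] at ht hab'
  set γ₂ : ℝ → M := fun t => γ' (1 * t + d) with hγ₂
  set η : ℝ → M := fun t => if t ≤ b then γ t else γ₂ t with hη
  have e1 : EqOn η γ (Icc a b) := fun t ht => if_pos ht.2
  have e2 : EqOn η γ₂ (Icc b (b' - d)) := fun t ht => by
    rcases ht.1.eq_or_lt with rfl | hlt
    · simp [hη, hγ₂, hd, hb, ha']
    · exact if_neg (not_le.2 hlt)
  have p1 := hγ.congr e1
  have p2 := ht.congr e2
  refine ⟨a, b' - d, η, p1.append p2, (e1 ⟨le_rfl, hab⟩).trans ha, ?_, ?_⟩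
  · rw [e2 ⟨hab', le_rfl⟩]
    simpa [hγ₂] using hb'
  · rw [← g.arcLength_add p1 p2, g.arcLength_congr hab (e1.mono Ioo_subset_Icc_self),
      g.arcLength_congr hab' (e2.mono Ioo_subset_Icc_self), ← g.arcLength_translate γ' a' b' d]
    simp [hd, hγ₂]

lemma preDist_le (h : g.HasArc p q L) : g.preDist p q ≤ L :=
  csInf_le ⟨0, fun _ hx => HasArc.nonneg (g := g) hx⟩ h

lemma preDist_nonneg (g : SemidefMetric r M) (p q : M) : 0 ≤ g.preDist p q :=
  Real.sInf_nonneg fun _ hx => HasArc.nonneg (g := g) hx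

lemma preDist_self (g : SemidefMetric r M) (p : M) : g.preDist p p = 0 :=
  le_antisymm (preDist_le (HasArc.refl g p)) (g.preDist_nonneg p p)

lemma preDist_comm (g : SemidefMetric r M) (p q : M) : g.preDist p q = g.preDist q p := by
  refine congrArg sInf (Set.ext fun L => ⟨fun h => ?_, fun h => ?_⟩)
  · exact HasArc.symm (g := g) h
  · exact HasArc.symm (g := g) h

/-- An arc must exist: the real infimum of the empty set is `0` by convention. -/
lemma le_preDist {c : ℝ} (hne : ∃ L, g.HasArc p q L) (h : ∀ L, g.HasArc p q L → c ≤ L) :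
    c ≤ g.preDist p q :=
  le_csInf hne h

lemma preDist_triangle (hne : ∃ L, g.HasArc p q L) (hne' : ∃ L, g.HasArc q q' L) :
    g.preDist p q' ≤ g.preDist p q + g.preDist q q' := by
  rw [← sub_le_iff_le_add']
  refine le_preDist hne' fun L' h' => ?_
  rw [sub_le_comm]
  refine le_preDist hne fun L h => ?_
  linarith [preDist_le (h.trans h')]

/-! ### Short arcs and continuity of the pre-distance -/

section Chart

variable {e : OpenPartialHomeomorph M Plane}

/-- With `J` the quarter turn, `Q(v) + Q(J v) = (E + G) ‖v‖²`. -/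
lemma quadForm_le_trace_mul {E F G : ℝ} (h : ∀ v, 0 ≤ quadForm E F G v) (v : Plane) :
    quadForm E F G v ≤ (E + G) * ‖v‖ ^ 2 := by
  have := h (planeRot (v 0) (v 1))
  simp only [quadForm, planeRot_zero, planeRot_one] at this
  rw [plane_norm_sq, quadForm]
  linarith

lemma hasArc_segment (g : SemidefMetric r M) (he : e ∈ IsManifold.maximalAtlas (𝓡 2) ∞ M)
    {x y : Plane} {s : Set Plane} (hs : Convex ℝ s) (hst : s ⊆ e.target) (hx : x ∈ s) (hy : y ∈ s)
    {T : ℝ} (hT : ∀ z ∈ s, g.coeff e 0 0 z + g.coeff e 1 1 z ≤ T) :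
    ∃ L ≤ √T * ‖y - x‖, g.HasArc (e.symm x) (e.symm y) L := by
  set c : ℝ → Plane := fun t => x + t • (y - x) with hc
  have hcs : ∀ t ∈ Icc (0 : ℝ) 1, c t ∈ s := fun t ht => hs.add_smul_sub_mem hx hy ht
  have hcd : ∀ t, HasDerivAt c (y - x) t := fun t => by
    simpa [hc] using ((hasDerivAt_id t).smul_const (y - x)).const_add x
  have hsm : IsPiecewiseSmooth (e.symm ∘ c) 0 1 := by
    refine .smooth zero_le_one ((contMDiffOn_symm_of_mem_maximalAtlas he).comp
      (t := e.target) (ContDiff.contMDiff (by fun_prop)).contMDiffOn ?_)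
    exact fun t ht => hst (hcs t ht)
  refine ⟨_, ?_, 0, 1, _, hsm, by simp [hc], by simp [hc], rfl⟩
  have hb : ∀ t ∈ uIoc (0 : ℝ) 1, ‖g.speed (e.symm ∘ c) t‖ ≤ √T * ‖y - x‖ := by
    intro t ht
    rw [uIoc_of_le zero_le_one] at ht
    have hts := hcs t (Ioc_subset_Icc_self ht)
    have htt := hst hts
    have hmd := (mdifferentiable_of_mem_maximalAtlas he).mdifferentiableAt_symm htt
    have hγ : MDifferentiableAt 𝓘(ℝ, ℝ) (𝓡 2) (e.symm ∘ c) t :=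
      hmd.comp t (hcd t).differentiableAt.mdifferentiableAt
    have hd : deriv (e ∘ (e.symm ∘ c)) t = y - x := by
      refine ((hcd t).congr_of_eventuallyEq ?_).deriv
      filter_upwards [(hcd t).continuousAt.preimage_mem_nhds (e.open_target.mem_nhds htt)] with u hu
      exact e.right_inv hu
    rw [Real.norm_of_nonneg (g.speed_nonneg _ _), speed,
      g.form_velocity_self_eq_chartQuad he hγ (e.map_target htt), hd]
    simp only [Function.comp, e.right_inv htt]
    rw [Real.sqrt_le_left (by positivity), mul_pow]
    refine (quadForm_le_trace_mul (g.chartQuad_nonneg (c t)) _).trans ?_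
    have h0 : 0 ≤ T := (add_nonneg (g.nonneg _ _) (g.nonneg _ _)).trans (hT _ hts)
    rw [Real.sq_sqrt h0]
    exact mul_le_mul_of_nonneg_right (hT _ hts) (by positivity)
  have := intervalIntegral.norm_integral_le_of_norm_le_const hb
  rw [sub_zero, abs_one, mul_one] at this
  exact (le_abs_self _).trans this

/-- Nearby points are joined by short arcs. -/
lemma eventually_exists_hasArc_lt (g : SemidefMetric r M) (hr : 1 ≤ r) (p : M) {ε : ℝ}
    (hε : 0 < ε) : ∀ᶠ q in 𝓝 p, ∃ L < ε, g.HasArc p q L := by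
  set e := chartAt Plane p
  have he : e ∈ IsManifold.maximalAtlas (𝓡 2) ∞ M := IsManifold.chart_mem_maximalAtlas p
  have hp : p ∈ e.source := mem_chart_source Plane p
  have hx := e.map_source hp
  set T := g.coeff e 0 0 (e p) + g.coeff e 1 1 (e p) + 1
  have h1 : ∀ᶠ z in 𝓝 (e p), g.coeff e 0 0 z + g.coeff e 1 1 z < T :=
    ((g.contDiffAt_coeff hr he 0 0 hx).continuousAt.add
      (g.contDiffAt_coeff hr he 1 1 hx).continuousAt).eventually_lt continuousAt_const
      (lt_add_one (g.coeff e 0 0 (e p) + g.coeff e 1 1 (e p)))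
  obtain ⟨ρ, hρ, hball⟩ := Metric.eventually_nhds_iff_ball.1 (h1.and (e.open_target.mem_nhds hx))
  have h2 : ∀ᶠ y in 𝓝 (e p), √T * ‖y - e p‖ < ε := by
    have : ContinuousAt (fun y => √T * ‖y - e p‖) (e p) := by fun_prop
    exact this.eventually_lt continuousAt_const (by simpa using hε)
  filter_upwards [(e.continuousAt hp).eventually h2, e.open_source.mem_nhds hp,
    (e.continuousAt hp).eventually (Metric.ball_mem_nhds _ hρ)] with q hq hqs hqb
  obtain ⟨L, hL, harc⟩ := g.hasArc_segment he (convex_ball (e p) ρ) (fun z hz => (hball z hz).2)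
    (Metric.mem_ball_self hρ) hqb (fun z hz => (hball z hz).1.le)
  rw [e.left_inv hp, e.left_inv hqs] at harc
  exact ⟨L, hL.trans_lt hq, harc⟩

/-- Being joined by an arc is symmetric and transitive and holds locally, so connectedness extends
it to all pairs. -/
lemma exists_hasArc [PreconnectedSpace M] (g : SemidefMetric r M) (hr : 1 ≤ r) (p q : M) :
    ∃ L, g.HasArc p q L := by
  have htrans : IsTrans M fun p q => ∃ L, g.HasArc p q L :=
    ⟨fun _ _ _ ⟨_, h⟩ ⟨_, h'⟩ => ⟨_, h.trans h'⟩⟩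
  have hsymm : Std.Symm fun p q : M => ∃ L, g.HasArc p q L := ⟨fun _ _ ⟨_, h⟩ => ⟨_, h.symm⟩⟩
  refine PreconnectedSpace.induction₂ (fun p q => ∃ L, g.HasArc p q L) (fun p => ?_) htrans p q
  filter_upwards [g.eventually_exists_hasArc_lt hr p one_pos] with q ⟨L, _, h⟩
  exact ⟨L, h⟩

lemma continuous_preDist [PreconnectedSpace M] (g : SemidefMetric r M) (hr : 1 ≤ r) (p : M) :
    Continuous (g.preDist p) := by
  refine continuous_iff_continuousAt.2 fun q => Metric.tendsto_nhds.2 fun ε hε => ?_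
  filter_upwards [g.eventually_exists_hasArc_lt hr q hε] with q' ⟨L, hL, h⟩
  have hne := g.exists_hasArc hr
  have h1 := preDist_triangle (hne p q) (hne q q')
  have h2 := preDist_triangle (hne p q') (hne q' q)
  have h3 := preDist_le h
  rw [g.preDist_comm q' q] at h2
  rw [Real.dist_eq, abs_lt]
  constructor <;> linarith

/-! ### Separation from the complement of a neighbourhood -/

/-- A curve leaving the preimage of a coordinate ball crosses the preimage of the sphere. -/
lemma exists_first_exit [T2Space M] {x : Plane} {ρ : ℝ} (hρ : 0 < ρ)
    (hball : Metric.closedBall x ρ ⊆ e.target) {γ : ℝ → M} {a b : ℝ} (hab : a ≤ b)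
    (hγ : ContinuousOn γ (Icc a b)) (ha : γ a = e.symm x) (hb : γ b ∉ e.symm '' Metric.ball x ρ) :
    ∃ s ∈ Icc a b, (∀ t ∈ Icc a s, γ t ∈ e.source ∧ e (γ t) ∈ Metric.closedBall x ρ) ∧
      e (γ s) ∈ Metric.sphere x ρ := by
  set W := e.symm '' Metric.ball x ρ with hW
  set K := e.symm '' Metric.closedBall x ρ with hK
  have hWo : IsOpen W := e.isOpen_image_symm_of_subset_target Metric.isOpen_ball
    (Metric.ball_subset_closedBall.trans hball)
  -- Hausdorffness enters here: the compact set `K` is closed, so the first exit point is still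
  -- inside the chart.
  have hKc : IsClosed K := ((isCompact_closedBall x ρ).image_of_continuousOn
    (e.continuousOn_symm.mono hball)).isClosed
  have hWK : W ⊆ K := image_mono Metric.ball_subset_closedBall
  have hKe : ∀ z ∈ K, z ∈ e.source ∧ e z ∈ Metric.closedBall x ρ := by
    rintro _ ⟨y, hy, rfl⟩
    exact ⟨e.map_target (hball hy), by rwa [e.right_inv (hball hy)]⟩
  set S := Icc a b ∩ γ ⁻¹' Wᶜ with hS
  have hSc : IsClosed S := hγ.preimage_isClosed_of_isClosed isClosed_Icc hWo.isClosed_compl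
  have hSne : S.Nonempty := ⟨b, ⟨hab, le_rfl⟩, hb⟩
  have hSb : BddBelow S := ⟨a, fun t ht => ht.1.1⟩
  set s := sInf S
  have hsS : s ∈ S := hSc.csInf_mem hSne hSb
  have hlt : ∀ t ∈ Ico a s, γ t ∈ W := by
    intro t ht
    by_contra hcon
    exact absurd (csInf_le hSb ⟨⟨ht.1, ht.2.le.trans hsS.1.2⟩, hcon⟩) (not_le.2 ht.2)
  have haW : γ a ∈ W := by rw [ha]; exact mem_image_of_mem _ (Metric.mem_ball_self hρ)
  have has : a ≠ s := by
    intro h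
    exact hsS.2 (h ▸ haW)
  have hsK : γ s ∈ K := by
    have h1 : ContinuousWithinAt γ (Ico a s) s := (hγ s hsS.1).mono
      (Ico_subset_Icc_self.trans (Icc_subset_Icc_right hsS.1.2))
    have h2 : s ∈ closure (Ico a s) := by
      rw [closure_Ico has]; exact ⟨hsS.1.1, le_rfl⟩
    have := h1.mem_closure h2 (fun t ht => hWK (hlt t ht))
    rwa [hKc.closure_eq] at this
  refine ⟨s, hsS.1, fun t ht => ?_, ?_⟩
  · rcases ht.2.eq_or_lt with h | h
    · rw [h]; exact hKe _ hsK
    · exact hKe _ (hWK (hlt t ⟨ht.1, h⟩))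
  · refine le_antisymm (hKe _ hsK).2 (not_lt.1 fun h => hsS.2 ?_)
    exact ⟨_, h, e.left_inv (hKe _ hsK).1⟩

/-- `p` is metrically separated from the complement of each of its neighbourhoods. -/
def IsSeparated (g : SemidefMetric r M) (p : M) : Prop :=
  ∀ W ∈ 𝓝 p, ∃ ε > 0, ∀ q ∉ W, ∀ L, g.HasArc p q L → ε ≤ L

lemma exists_closedBall_subset {x : Plane} (hx : x ∈ e.target) {W : Set M} (hW : W ∈ 𝓝 (e.symm x))
    {s : Set Plane} (hs : s ∈ 𝓝 x) :
    ∃ ρ > 0, Metric.closedBall x ρ ⊆ e.target ∩ e.symm ⁻¹' W ∩ s :=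
  Metric.nhds_basis_closedBall.mem_iff.1 (inter_mem (inter_mem (e.open_target.mem_nhds hx)
    ((e.continuousAt_symm hx).preimage_mem_nhds hW)) hs)

lemma IsSeparated.of_isBarrier [T2Space M] (he : e ∈ IsManifold.maximalAtlas (𝓡 2) ∞ M) {x : Plane}
    (hx : x ∈ e.target) {Ψ : Plane → ℝ} {C : ℝ} (h : IsBarrier (g.chartQuad e) x Ψ C) :
    g.IsSeparated (e.symm x) := by
  intro W hW
  obtain ⟨ρ, hρ, hsub⟩ := exists_closedBall_subset hx hW h.2
  have hS : (Metric.sphere x ρ).Nonempty := NormedSpace.sphere_nonempty.2 hρ.le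
  obtain ⟨y, hy, hmin⟩ := (isCompact_sphere x ρ).exists_isMinOn hS (f := Ψ) fun z hz =>
    (hsub (Metric.sphere_subset_closedBall hz)).2.1.continuousAt.continuousWithinAt
  have hpos : 0 < Ψ y :=
    (hsub (Metric.sphere_subset_closedBall hy)).2.2.1 (Metric.ne_of_mem_sphere hy hρ.ne')
  -- Up to the first exit, `Ψ` rises from `0` to at least its minimum on the sphere, at a cost of at
  -- most `C` per unit length. Using `|C| + 1` keeps the denominator positive.
  refine ⟨Ψ y / (|C| + 1), by positivity, ?_⟩
  rintro q hq _ ⟨a, b, γ, hγ, ha, rfl, rfl⟩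
  obtain ⟨s, hs, hin, hexit⟩ := exists_first_exit hρ (fun z hz => (hsub hz).1.1) hγ.le
    hγ.continuousOn ha (by
      rintro ⟨z, hz, hzq⟩
      exact hq (hzq ▸ (hsub (Metric.ball_subset_closedBall hz)).1.2))
  have h1 := g.sub_le_mul_arcLength (hγ.left_part hs) he (fun t ht => (hin t ht).1)
    (fun t ht => (hsub (hin t ht).2).2.1) (fun t ht => (hsub (hin t ht).2).2.2.2)
  rw [ha, e.right_inv hx, h.1, sub_zero] at h1
  have h2 := hmin hexit
  have h3 := g.arcLength_mono hγ hs
  have h4 := g.arcLength_nonneg γ hs.1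
  rw [div_le_iff₀ (by positivity)]
  simp only [mem_ofPred_eq] at h2
  nlinarith [le_abs_self C, abs_nonneg C]

lemma IsSeparated.of_not_isSemidefPoint [T2Space M] (hr : 1 ≤ r) (h : ¬ g.IsSemidefPoint p) :
    g.IsSeparated p := by
  set e := chartAt Plane p
  have he : e ∈ IsManifold.maximalAtlas (𝓡 2) ∞ M := IsManifold.chart_mem_maximalAtlas p
  have hp : p ∈ e.source := mem_chart_source Plane p
  rw [← e.left_inv hp] at h ⊢
  obtain ⟨Ψ, C, hΨ⟩ := g.exists_isBarrier_of_not_isSemidefPoint hr he (e.map_source hp) h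
  exact .of_isBarrier he (e.map_source hp) hΨ

lemma IsSeparated.of_isA2Point [T2Space M] (hr : ∞ ≤ r) (hg : g.IsKossowski)
    (h : g.IsA2Point p) : g.IsSeparated p := by
  obtain ⟨-, e, he, hp, lam, hlam, hD, hdlam⟩ := hg p h.1
  have he' := IsManifold.maximalAtlas_subset_of_le hr he
  obtain ⟨Ψ, C, hΨ⟩ := g.exists_isBarrier_of_isA2Point (le_trans (by norm_cast) hr) he' hp h hlam hD hdlam
  rw [← e.left_inv hp]
  exact .of_isBarrier he' (e.map_source hp) hΨ

lemma IsSeparated.preDist_pos [PreconnectedSpace M] [T1Space M] (hr : 1 ≤ r)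
    (h : g.IsSeparated p) (hpq : p ≠ q) : 0 < g.preDist p q := by
  obtain ⟨ε, hε, hL⟩ := h {q}ᶜ (isOpen_compl_singleton.mem_nhds hpq)
  exact hε.trans_le (le_preDist (g.exists_hasArc hr p q) (hL q (by simp)))

/-- If all points near `p`, except perhaps `p`, are separated, then so is `p`. -/
lemma IsSeparated.of_eventually [PreconnectedSpace M] [T2Space M] (hr : 1 ≤ r)
    (h : ∀ᶠ q in 𝓝 p, q ≠ p → g.IsSeparated q) : g.IsSeparated p := by
  intro W hW
  set e := chartAt Plane p
  have hp : p ∈ e.source := mem_chart_source Plane p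
  have hx := e.map_source hp
  obtain ⟨ρ, hρ, hsub⟩ := exists_closedBall_subset hx (W := W ∩ {q | q ≠ p → g.IsSeparated q})
    (by rw [e.left_inv hp]; exact inter_mem hW h) univ_mem
  have hS : (Metric.sphere (e p) ρ).Nonempty := NormedSpace.sphere_nonempty.2 hρ.le
  obtain ⟨y, hy, hmin⟩ := (isCompact_sphere (e p) ρ).exists_isMinOn hS
    (f := fun z => g.preDist p (e.symm z)) fun z hz =>
      (g.continuous_preDist hr p).continuousAt.comp_continuousWithinAt
        (e.continuousAt_symm
          (hsub (Metric.sphere_subset_closedBall hz)).1.1).continuousWithinAt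
  have hy' := hsub (Metric.sphere_subset_closedBall hy)
  have hne : e.symm y ≠ p := by
    intro hcon
    apply Metric.ne_of_mem_sphere hy hρ.ne'
    rw [← e.right_inv hy'.1.1, hcon]
  refine ⟨g.preDist p (e.symm y), ?_, ?_⟩
  -- By symmetry, separation of the other endpoint `e.symm y` suffices; nothing about the metric at
  -- `p` is needed.
  · rw [g.preDist_comm]
    exact (hy'.1.2.2 hne).preDist_pos hr hne
  · rintro q hq _ ⟨a, b, γ, hγ, ha, rfl, rfl⟩
    obtain ⟨s, hs, hin, hexit⟩ := exists_first_exit (e := e) hρ (fun z hz => (hsub hz).1.1) hγ.le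
      hγ.continuousOn (ha.trans (e.left_inv hp).symm) (by
        rintro ⟨z, hz, hzq⟩
        exact hq (hzq ▸ (hsub (Metric.ball_subset_closedBall hz)).1.2.1))
    have h1 : g.preDist p (e.symm y) ≤ g.preDist p (e.symm (e (γ s))) := hmin hexit
    rw [e.left_inv (hin s ⟨hs.1, le_rfl⟩).1] at h1
    exact h1.trans ((preDist_le ⟨a, s, γ, hγ.left_part hs, ha, rfl, rfl⟩).trans
      (g.arcLength_mono hγ hs))

lemma isSeparated_of_forall_isPeak [PreconnectedSpace M] [T2Space M] (hr : ∞ ≤ r)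
    (hg : g.IsKossowski) (hpeak : ∀ p : M, g.IsSemidefPoint p → g.IsPeak p) (p : M) :
    g.IsSeparated p := by
  have hr1 : 1 ≤ r := le_trans (by norm_cast) hr
  by_cases hp : g.IsSemidefPoint p
  · obtain ⟨-, U, hU, hA2⟩ := hpeak p hp
    refine .of_eventually hr1 ?_
    filter_upwards [hU] with q hq hqp
    by_cases hqs : g.IsSemidefPoint q
    · exact .of_isA2Point hr hg (hA2 q ⟨hq, hqp⟩ hqs)
    · exact .of_not_isSemidefPoint hr1 hqs
  · exact .of_not_isSemidefPoint hr1 hp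

end Chart
end SemidefMetric

end

theorem mainTheorem8 {M : Type*} [topM : TopologicalSpace M] [T2Space M] [ConnectedSpace M]
    [ChartedSpace Plane M] [IsManifold (𝓡 2) ∞ M]
    (r : ℕ∞ω) (hr : r = ∞ ∨ r = ω) [IsManifold (𝓡 2) r M]
    (g : SemidefMetric r M) (hg : g.IsKossowski)
    (hpeak : ∀ p : M, g.IsSemidefPoint p → g.IsPeak p) :
    ∃ m : MetricSpace M, (∀ p q : M, m.dist p q = g.preDist p q) ∧
      m.toUniformSpace.toTopologicalSpace = topM := by
  have hr' : ∞ ≤ r := by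
    rcases hr with rfl | rfl
    · exact le_rfl
    · exact le_top
  have hr1 : 1 ≤ r := le_trans (by norm_cast) hr'
  have hsep := SemidefMetric.isSeparated_of_forall_isPeak hr' hg hpeak
  have hne := g.exists_hasArc hr1
  refine ⟨MetricSpace.ofDistTopology g.preDist g.preDist_self g.preDist_comm
    (fun x y z => SemidefMetric.preDist_triangle (hne x y) (hne y z)) (fun s => ?_)
    (fun x y hxy => ?_), fun p q => rfl, rfl⟩
  -- Separation puts a metric ball inside each neighbourhood; short arcs put a neighbourhood inside
  -- each metric ball.
  · rw [isOpen_iff_mem_nhds]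
    refine forall₂_congr fun x _ => ⟨fun h => ?_, fun ⟨ε, hε, h⟩ => ?_⟩
    · obtain ⟨ε, hε, hL⟩ := hsep x s h
      refine ⟨ε, hε, fun y hy => ?_⟩
      by_contra hys
      exact absurd (SemidefMetric.le_preDist (hne x y) (hL y hys)) (not_le.2 hy)
    · filter_upwards [g.eventually_exists_hasArc_lt hr1 x hε] with y ⟨L, hL, harc⟩
      exact h y ((SemidefMetric.preDist_le harc).trans_lt hL)
  · by_contra hcon
    exact ((hsep x).preDist_pos hr1 hcon).ne' hxy
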